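/- Let $\langle M,\in^M\rangle\models\mathrm{ZF}$ be a countable (not necessarily well-founded) model of set theory, let $1\le n<\omega$ and let $X\subseteq M^n$. Conventions. A presentation of $M$ is a structure $\langle\omega,R\rangle$ isomorphic to $\langle M,\in^M\rangle$. All syntax is in the signature $\{\in,=\}$, and $\Sigma_1$ refers to the arithmetical (not the Lévy) hierarchy: a finitary $\Sigma_1$ formula is $\exists\vec y\,\gamma(\vec x,\vec y)$ with $\gamma$ quantifier-free, and a $\Sigma_1$ formula of $\mathcal L_{\omega_1,\omega}$ is a countable disjunction of such formulas in the same free variables $x_0,\dots,x_{n-1}$. Formulas and finite graphs are identified with their codes in $\omega$. A c.e. operator is given by a c.e. set $W$ of pairs $(\sigma,x)$ with $\sigma\in 2^{<\omega}$ and $x\in\omega$; on the oracle $A$ it outputs $W^A=\{x:\exists\sigma\,((\sigma,x)\in W\text{ and }\sigma\text{ is an initial segment of the characteristic function of }A)\}$. An enumeration operator $\Psi$ is given by a c.e. set of pairs $(D,x)$ with $D\subset\omega$ finite; $\Psi(A)=\{x:\exists D\subseteq A\ (D,x)\in\Psi\}$, and $S$ is $e$-reducible to $A$ if $S=\Psi(A)$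 for some enumeration operator $\Psi$. For $a\in M$ let $\mathrm{TC}(\{a\})$ be the set of all $b\in M$ for which there is a finite chain $b=c_0\in^M c_1\in^M\dots\in^M c_k=a$ with $k\ge0$. A finite pattern is a finite directed graph with $n$ distinguished, not necessarily distinct, vertices $p_0,\dots,p_{n-1}$. It is found at $\vec a\in M^n$ if it is isomorphic to an induced subgraph of $\bigl(\bigcup_i\mathrm{TC}(\{a_i\}),\in^M\bigr)$ by an isomorphism sending each $p_i$ to $a_i$. "$S\subseteq\omega$ is $e$-reducible to the $\Sigma_1$-diagram of $M$" may be read in either of two ways that do not depend on a choice of presentation: (a) $S$ is $e$-reducible to the set of (parameter-free) $\Sigma_1$ sentences true in $M$; (b) there is a single enumeration operator $\Psi$ such that, for every presentation of $M$, $\Psi$ applied to the $\Sigma_1$-diagram of that presentation, with parameters from $\omega$, is $S$. Theorem. The following are equivalent, where (2) and (3) may each be read in the sense (a) or in the sense (b); that is, the five resulting conditions are all equivalent. (1) $X$ is uniformly relatively intrinsically computably enumerable in the atomic diagram of $M$: there is a single c.e. operator which, for every presentation of $M$ and every isomorphism of it with $M$, given the atomic diagram of the presentation, outputs exactly the copy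 of $X$ in that presentation. (2) There is a set $P$ of finite patterns that is $e$-reducible to the $\Sigma_1$-diagram of $M$ such that, for every $\vec a\in M^n$, $\vec a\in X$ if and only if some pattern in $P$ is found at $\vec a$. (3) There is a $\Sigma_1$ formula $\varphi(\vec x)$ of $\mathcal L_{\omega_1,\omega}$ which defines $X$ in $M$ and whose set of (finite) disjuncts is $e$-reducible to the $\Sigma_1$-diagram of $M$. -/

import Mathlib

namespace SetModel

universe u

/-! ### Models of ZF -/

/-- The only non-logical symbol of the language of set theory: a binary relation symbol. -/
inductive SetRel : ℕ → Type
  | mem : SetRel 2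

/-- The first-order language `{∈}` (equality is a logical symbol). -/
def setLanguage : FirstOrder.Language := ⟨fun _ => Empty, SetRel⟩

/-- The structure `⟨M, E⟩` in the language `{∈}`. -/
@[reducible] def setStructure {M : Type u} (E : M → M → Prop) : setLanguage.Structure M where
  funMap := fun f => Empty.elim f
  RelMap := fun r =>
    match r with
    | SetRel.mem => fun v => E (v 0) (v 1)

/-- `s ⊆ M` is first-order definable in `⟨M, E⟩` with parameters from `M`. -/
def ParamDefinable₁ {M : Type u} (E : M → M → Prop) (s : Set M) : Prop :=
  letI := setStructure E
  (Set.univ : Set M).Definable₁ setLanguage s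

/-- The binary relation `r` is first-order definable in `⟨M, E⟩` with parameters from `M`. -/
def ParamDefinable₂ {M : Type u} (E : M → M → Prop) (r : M → M → Prop) : Prop :=
  letI := setStructure E
  (Set.univ : Set M).Definable₂ setLanguage {p : M × M | r p.1 p.2}

/-- `⟨M, E⟩ ⊨ ZF`. The two schemes range over all first-order formulas with parameters. -/
structure IsModelZF {M : Type u} (E : M → M → Prop) : Prop where
  extensionality : ∀ a b, (∀ x, E x a ↔ E x b) → a = b
  foundation : ∀ a, (∃ x, E x a) → ∃ x, E x a ∧ ∀ y, E y x → ¬ E y a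
  pairing : ∀ a b, ∃ c, ∀ x, E x c ↔ x = a ∨ x = b
  union : ∀ a, ∃ c, ∀ x, E x c ↔ ∃ y, E y a ∧ E x y
  powerset : ∀ a, ∃ c, ∀ x, E x c ↔ ∀ y, E y x → E y a
  infinity : ∃ w, (∃ z, E z w ∧ ∀ x, ¬ E x z) ∧
    ∀ x, E x w → ∃ y, E y w ∧ ∀ z, E z y ↔ E z x ∨ z = x
  separation : ∀ s : Set M, ParamDefinable₁ E s → ∀ a, ∃ b, ∀ x, E x b ↔ E x a ∧ x ∈ s
  replacement : ∀ r : M → M → Prop, ParamDefinable₂ E r → ∀ a,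
    (∀ x, E x a → ∃! y, r x y) → ∃ b, ∀ y, E y b ↔ ∃ x, E x a ∧ r x y

/-! ### Computably enumerable operators and enumeration reducibility -/

/-- A computably enumerable operator `A ↦ W^A`: a c.e. set of pairs `(σ, x)`, read as
"`x` is enumerated by any oracle whose characteristic function extends the finite string `σ`". -/
structure CEOperator where
  rules : Set (List Bool × ℕ)
  ce : REPred fun p : List Bool × ℕ => p ∈ rules

/-- The set that a c.e. operator enumerates from the oracle `A`. -/
def CEOperator.apply (W : CEOperator) (A : Set ℕ) : Set ℕ :=
  {x | ∃ σ : List Bool, (σ, x) ∈ W.rules ∧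
    ∀ (i : ℕ) (h : i < σ.length), σ[i] = true ↔ i ∈ A}

/-- An enumeration operator: a c.e. set of pairs `(D, x)` with `D` (a list listing) a finite set. -/
structure EnumOperator where
  rules : Set (List ℕ × ℕ)
  ce : REPred fun p : List ℕ × ℕ => p ∈ rules

/-- The set that an enumeration operator produces from (any enumeration of) `A`. -/
def EnumOperator.apply (Ψ : EnumOperator) (A : Set ℕ) : Set ℕ :=
  {x | ∃ D : List ℕ, (D, x) ∈ Ψ.rules ∧ ∀ d ∈ D, d ∈ A}

/-- `S` is enumeration-reducible to `A`. -/
def EReducible (S A : Set ℕ) : Prop :=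
  ∃ Ψ : EnumOperator, Ψ.apply A = S

/-! ### Quantifier-free formulas and existential formulas -/

/-- Finitary quantifier-free formulas of the language `{∈, =}` in the variables `v₀, v₁, v₂, …`. -/
inductive QF : Type
  | eq (i j : ℕ) : QF
  | mem (i j : ℕ) : QF
  | not (φ : QF) : QF
  | and (φ ψ : QF) : QF
  | or (φ ψ : QF) : QF

/-- Satisfaction of a quantifier-free formula in `⟨M, E⟩` under the assignment `v`. -/
def QF.Realize {M : Type u} (E : M → M → Prop) (v : ℕ → M) : QF → Prop
  | .eq i j => v i = v j
  | .mem i j => E (v i) (v j)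
  | .not φ => ¬ φ.Realize E v
  | .and φ ψ => φ.Realize E v ∧ ψ.Realize E v
  | .or φ ψ => φ.Realize E v ∨ ψ.Realize E v

/-- Gödel numbers of quantifier-free formulas. -/
def QF.code : QF → ℕ
  | .eq i j => 5 * Nat.pair i j
  | .mem i j => 5 * Nat.pair i j + 1
  | .not φ => 5 * φ.code + 2
  | .and φ ψ => 5 * Nat.pair φ.code ψ.code + 3
  | .or φ ψ => 5 * Nat.pair φ.code ψ.code + 4

theorem QF.code_injective : Function.Injective QF.code := by
  intro φ
  induction φ with
  | eq i j =>
    intro ψ h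
    cases ψ <;> simp only [QF.code] at h <;> first | omega | skip
    have h' := Nat.pair_eq_pair.1 (Nat.eq_of_mul_eq_mul_left (by norm_num) h)
    rw [h'.1, h'.2]
  | mem i j =>
    intro ψ h
    cases ψ <;> simp only [QF.code] at h <;> first | omega | skip
    have h' := Nat.pair_eq_pair.1 (Nat.eq_of_mul_eq_mul_left (by norm_num) (Nat.add_right_cancel h))
    rw [h'.1, h'.2]
  | not φ ih =>
    intro ψ h
    cases ψ <;> simp only [QF.code] at h <;> first | omega | skip
    have h' := ih (Nat.eq_of_mul_eq_mul_left (by norm_num) (Nat.add_right_cancel h))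
    rw [h']
  | and φ₁ φ₂ ih₁ ih₂ =>
    intro ψ h
    cases ψ <;> simp only [QF.code] at h <;> first | omega | skip
    have h' := Nat.pair_eq_pair.1 (Nat.eq_of_mul_eq_mul_left (by norm_num) (Nat.add_right_cancel h))
    rw [ih₁ h'.1, ih₂ h'.2]
  | or φ₁ φ₂ ih₁ ih₂ =>
    intro ψ h
    cases ψ <;> simp only [QF.code] at h <;> first | omega | skip
    have h' := Nat.pair_eq_pair.1 (Nat.eq_of_mul_eq_mul_left (by norm_num) (Nat.add_right_cancel h))
    rw [ih₁ h'.1, ih₂ h'.2]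

/-- The existential formula `∃ y⃗ γ(x⃗, y⃗)` holds in `⟨M, E⟩` at the tuple `a`. Here `x⃗` is
`v₀, …, v_{n-1}`, and `y⃗` consists of all other variables (only finitely many of which occur
in `γ`). For `n = 0` this is the truth of an existential sentence. -/
def QF.ExRealize {M : Type u} (E : M → M → Prop) {n : ℕ} (γ : QF) (a : Fin n → M) : Prop :=
  ∃ v : ℕ → M, (∀ i : Fin n, v i = a i) ∧ γ.Realize E v

/-- The `Σ₁`-diagram of `⟨M, E⟩` without parameters: the (codes of) existential sentences of the
language `{∈, =}` that are true in `⟨M, E⟩`. -/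
def sigmaOneDiagram {M : Type u} (E : M → M → Prop) : Set ℕ :=
  {c | ∃ γ : QF, c = γ.code ∧ γ.ExRealize E (Fin.elim0 : Fin 0 → M)}

/-- The `Σ₁`-diagram, with parameters, of a structure `⟨ℕ, R⟩`: the (codes of) true statements
`∃ y⃗ γ(p⃗, y⃗)` with `γ` quantifier-free and `p⃗` a finite tuple of elements. -/
def sigmaOneDiagramWithParams (R : ℕ → ℕ → Prop) : Set ℕ :=
  {c | ∃ (γ : QF) (p : List ℕ), c = Nat.pair γ.code (Encodable.encode p) ∧ γ.ExRealize R p.get}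

/-- The atomic diagram of a structure `⟨ℕ, R⟩`: the (codes of) true atomic statements `i = j` and
`i ∈ j`, where `i` and `j` are elements of the structure. -/
def atomicDiagram (R : ℕ → ℕ → Prop) : Set ℕ :=
  {c | ∃ i j : ℕ, (c = (QF.eq i j).code ∧ i = j) ∨ (c = (QF.mem i j).code ∧ R i j)}

/-- One and the same enumeration operator produces `S` from the `Σ₁`-diagram (with parameters) of
every presentation of `⟨M, E⟩`, that is, of every structure `⟨ℕ, R⟩` isomorphic to it. -/
def UniformlyEReducibleToDiagrams {M : Type u} (E : M → M → Prop) (S : Set ℕ) : Prop :=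
  ∃ Ψ : EnumOperator, ∀ R : ℕ → ℕ → Prop, Nonempty (R ≃r E) →
    Ψ.apply (sigmaOneDiagramWithParams R) = S

/-! ### The three conditions -/

/-- Codes of finite tuples of natural numbers. -/
def tupleCode {n : ℕ} (x : Fin n → ℕ) : ℕ := Encodable.encode (List.ofFn x)

/-- `X ⊆ Mⁿ` is uniformly relatively intrinsically computably enumerable in the atomic diagram:
a single c.e. operator outputs, for every structure `⟨ℕ, R⟩` and every isomorphism of it with
`⟨M, E⟩`, the copy of `X` in that presentation, from the atomic diagram of `⟨ℕ, R⟩`. -/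
def UniformlyRICE {M : Type u} (E : M → M → Prop) {n : ℕ} (X : Set (Fin n → M)) : Prop :=
  ∃ W : CEOperator, ∀ (R : ℕ → ℕ → Prop) (e : R ≃r E),
    W.apply (atomicDiagram R) = tupleCode '' {x : Fin n → ℕ | (fun i => e (x i)) ∈ X}

/-- A finite pattern: a finite directed graph, `adj u v = true` meaning "`u ∈ v`", with `n`
distinguished (not necessarily distinct) vertices. -/
structure Pattern (n : ℕ) where
  size : ℕ
  point : Fin n → Fin size
  adj : Fin size → Fin size → Bool

/-- Codes of patterns: the size, the list of distinguished vertices, and the adjacency matrix. -/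
def Pattern.code {n : ℕ} (p : Pattern n) : ℕ :=
  Nat.pair p.size (Nat.pair (Encodable.encode (List.ofFn fun i => (p.point i : ℕ)))
    (Encodable.encode (List.ofFn fun i => List.ofFn fun j => p.adj i j)))

theorem Pattern.code_injective {n : ℕ} : Function.Injective (Pattern.code (n := n)) := by
  rintro ⟨k, f, A⟩ ⟨k', f', A'⟩ h
  simp only [Pattern.code, Nat.pair_eq_pair] at h
  obtain ⟨rfl, h₁, h₂⟩ := h
  have h₁ := List.ofFn_injective (Encodable.encode_injective h₁)
  have h₂ := List.ofFn_injective (Encodable.encode_injective h₂)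
  congr 1
  · funext i
    exact Fin.ext (congrFun h₁ i)
  · funext i
    exact List.ofFn_injective (congrFun h₂ i)

/-- The transitive closure of `{a}` in the graph `⟨M, E⟩`: `a` and everything that is reached from
`a` by finitely many steps from a set to one of its elements. -/
def TC {M : Type u} (E : M → M → Prop) (a : M) : Set M :=
  {b | Relation.ReflTransGen E b a}

/-- The pattern `p` is found at `a`: `p` is isomorphic to an induced subgraph of the transitive
closures of `{a₀}, …, {a_{n-1}}` with the relation `E`, the distinguished vertices
corresponding to `a₀, …, a_{n-1}`. -/
def Pattern.FoundAt {M : Type u} (E : M → M → Prop) {n : ℕ} (p : Pattern n) (a : Fin n → M) :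
    Prop :=
  ∃ f : Fin p.size → M, Function.Injective f ∧ (∀ i, f (p.point i) = a i) ∧
    (∀ u, ∃ i, f u ∈ TC E (a i)) ∧ ∀ u v, p.adj u v = true ↔ E (f u) (f v)

/-- The list `P` of patterns witnesses membership in `X`: `a ∈ X` if and only if one of the patterns
in the list is found at `a`. -/
def WitnessesMembership {M : Type u} (E : M → M → Prop) {n : ℕ} (P : Set (Pattern n))
    (X : Set (Fin n → M)) : Prop :=
  ∀ a, a ∈ X ↔ ∃ p ∈ P, p.FoundAt E a

/-- A `Σ₁` formula `⋁ ∃ y⃗ γ(x⃗, y⃗)` of `L_{ω₁,ω}` with free variables `x⃗ = v₀, …, v_{n-1}`. It is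
given by the (automatically countable) set of the matrices `γ` of its disjuncts, which are finitary
quantifier-free formulas; the variables of `γ` other than `x⃗` are quantified existentially. -/
structure InfSigmaOne (n : ℕ) where
  disjuncts : Set QF

/-- The `Σ₁` formula `φ` of `L_{ω₁,ω}` defines `X` in `⟨M, E⟩`. -/
def InfSigmaOne.Defines {M : Type u} (E : M → M → Prop) {n : ℕ} (φ : InfSigmaOne n)
    (X : Set (Fin n → M)) : Prop :=
  ∀ a, a ∈ X ↔ ∃ γ ∈ φ.disjuncts, γ.ExRealize E a

end SetModel

/-!
The argument rests on one property of models of `ZF`: a finite set `S` of elements always has a new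
element `y` whose members in `S` are prescribed, and which is a member of no element of `S`
(`IsModelZF.exists_new_vertex`; take `y = T ∪ {w}` with `w = S ∪ ⋃ S ∪ ⋃ ⋃ S`). By foundation every
finite induced subgraph of `⟨M, E⟩` is acyclic, so it can be enumerated such that edges go from
earlier to later vertices, where a part that is closed under predecessors may come first
(`IsModelZF.exists_layered`). Conversely, an embedding of such an initial part extends to the whole
graph (`IsModelZF.exists_embeds`).

* With the empty initial part, this shows that the existential sentences true in `M` are those true
  in some nonempty finite acyclic graph. So the `Σ₁`-diagram of `M` is c.e., and a set is
  `e`-reducible to it if and only if it is c.e. (`EReducible.rePred`). If one enumeration operator produces `S` from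
  the diagram of every presentation, then `x ∈ S` if and only if it has a rule `(D, x)` for which
  *some* presentation satisfies `D`; for the same reason this is a c.e. condition
  (`UniformlyEReducibleToDiagrams.rePred`). Hence all four conditions
  on patterns or formulas just say that the set of patterns or of disjuncts is c.e.
* With the part inside the transitive closures of the `aᵢ` as the initial part, it shows that an
  existential formula holds at `a` if and only if one of a c.e. set of patterns is found at `a`
  (`IsModelZF.exRealize_of_forces`, `IsModelZF.exists_forces`). This leads from formulas to
  patterns.
* A pattern found at `a` is recognised in a presentation from finitely many facts of its atomic
  diagram, among them the chains that lead from the vertices to the `aᵢ`. This leads from patterns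
  to a c.e. operator (`WitnessesMembership.uniformlyRICE`).
* Given a c.e. operator that works for all presentations, the finite part of the atomic diagram that
  a computation uses is expressed by a quantifier-free formula, and every finite partial injection
  of `ℕ` into `M` extends to a presentation. Hence `X` is defined by the disjunction of
  these formulas over all computations (`UniformlyRICE.exists_formula`).

All the sets involved are shown to be c.e. by exhibiting certificates with a primitive recursive
test; the recursive core is the truth of coded formulas in finite graphs (`primrecPred_realize`).
-/

/-! ### Computably enumerable predicates -/

namespace SetModel

section Computability

variable {α β γ : Type*} [Primcodable α] [Primcodable β] [Primcodable γ]

theorem primrecPred_forall_mem {p : α → β → Prop} {f : α → List β} (hp : PrimrecRel p)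
    (hf : Primrec f) : PrimrecPred fun a => ∀ b ∈ f a, p a b :=
  PrimrecRel.comp (R := fun l a => ∀ b ∈ l, p a b) (PrimrecRel.forall_mem_list hp.swap) hf
    Primrec.id

theorem primrecPred_forall_lt {p : α → ℕ → Prop} {f : α → ℕ} (hp : PrimrecRel p)
    (hf : Primrec f) : PrimrecPred fun a => ∀ i < f a, p a i :=
  (primrecPred_forall_mem hp (Primrec.list_range.comp hf)).of_eq fun _ => by simp

theorem primrecPred_exists_lt {p : α → ℕ → Prop} {f : α → ℕ} (hp : PrimrecRel p)
    (hf : Primrec f) : PrimrecPred fun a => ∃ i < f a, p a i :=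
  (primrecPred_forall_lt hp.not hf).not.of_eq fun _ => by simp

theorem primrecPred_imp {p q : α → Prop} (hp : PrimrecPred p) (hq : PrimrecPred q) :
    PrimrecPred fun a => p a → q a :=
  (hp.not.or hq).of_eq fun _ => imp_iff_not_or.symm

theorem primrecPred_iff {p q : α → Prop} (hp : PrimrecPred p) (hq : PrimrecPred q) :
    PrimrecPred fun a => (p a ↔ q a) :=
  ((primrecPred_imp hp hq).and (primrecPred_imp hq hp)).of_eq fun _ => iff_def.symm

theorem rePred_of_exists_primrec {q : α → ℕ → Prop} (hq : PrimrecRel q) :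
    REPred fun a => ∃ k, q a k := by
  classical
  have h : Partrec fun a => Nat.rfind fun k => Part.some (decide (q a k)) :=
    Partrec.rfind (Computable.partrec (Primrec.to_comp hq.decide))
  refine h.dom_re.of_eq fun a => ?_
  refine Nat.rfind_dom'.trans ?_
  simp

/-- The normal form of c.e. predicates: the projection of a primitive recursive relation. -/
theorem rePred_iff_exists_primrec {p : α → Prop} :
    REPred p ↔ ∃ q : α → ℕ → Prop, PrimrecRel q ∧ ∀ a, p a ↔ ∃ k, q a k := by
  constructor
  · intro hp
    obtain ⟨c, hc⟩ := Nat.Partrec.Code.exists_code.1 hp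
    refine ⟨fun a k => (c.evaln k (Encodable.encode a)).isSome = true, ?_, fun a => ?_⟩
    · refine Primrec.eq.comp (Primrec.option_isSome.comp
        (Nat.Partrec.Code.primrec_evaln.comp
          ((Primrec.snd.pair (Primrec.const c)).pair (Primrec.encode.comp Primrec.fst))))
        (Primrec.const true)
    · have h := congrFun hc (Encodable.encode a)
      have h' : p a ↔ (c.eval (Encodable.encode a)).Dom := by
        rw [h]
        simp [Part.assert]
      rw [h', Part.dom_iff_mem]
      simp only [Nat.Partrec.Code.evaln_complete, Option.isSome_iff_exists]
      exact exists_comm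
  · rintro ⟨q, hq, h⟩
    exact (rePred_of_exists_primrec hq).of_eq fun a => (h a).symm

theorem rePred_of_primrecPred {p : α → Prop} (hp : PrimrecPred p) : REPred p :=
  rePred_iff_exists_primrec.2 ⟨fun a _ => p a, hp.comp Primrec.fst, fun _ => by simp⟩

theorem rePred_comp {p : β → Prop} (hp : REPred p) {f : α → β} (hf : Primrec f) :
    REPred fun a => p (f a) := by
  obtain ⟨q, hq, h⟩ := rePred_iff_exists_primrec.1 hp
  exact rePred_iff_exists_primrec.2
    ⟨fun a k => q (f a) k, hq.comp (hf.comp Primrec.fst) Primrec.snd, fun a => h (f a)⟩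

theorem rePred_and {p q : α → Prop} (hp : REPred p) (hq : REPred q) :
    REPred fun a => p a ∧ q a := by
  obtain ⟨p', hp', h⟩ := rePred_iff_exists_primrec.1 hp
  obtain ⟨q', hq', h'⟩ := rePred_iff_exists_primrec.1 hq
  refine rePred_iff_exists_primrec.2 ⟨fun a k => p' a k.unpair.1 ∧ q' a k.unpair.2, ?_, fun a => ?_⟩
  · exact (hp'.comp Primrec.fst (Primrec.fst.comp (Primrec.unpair.comp Primrec.snd))).and
      (hq'.comp Primrec.fst (Primrec.snd.comp (Primrec.unpair.comp Primrec.snd)))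
  · rw [h, h']
    constructor
    · rintro ⟨⟨k, hk⟩, l, hl⟩
      exact ⟨Nat.pair k l, by simpa using ⟨hk, hl⟩⟩
    · rintro ⟨k, hk, hl⟩
      exact ⟨⟨_, hk⟩, _, hl⟩

theorem rePred_exists {p : α → β → Prop} (hp : REPred fun x : α × β => p x.1 x.2) :
    REPred fun a => ∃ b, p a b := by
  classical
  obtain ⟨q, hq, h⟩ := rePred_iff_exists_primrec.1 hp
  refine rePred_iff_exists_primrec.2
    ⟨fun a k => ((Encodable.decode (α := β) k.unpair.1).map
      fun b => decide (q (a, b) k.unpair.2)).getD false = true, ?_, fun a => ?_⟩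
  · refine Primrec.eq.comp (Primrec.option_getD.comp (Primrec.option_map
      (Primrec.decode.comp (Primrec.fst.comp (Primrec.unpair.comp Primrec.snd))) ?_)
      (Primrec.const false)) (Primrec.const true)
    exact hq.decide.comp ((Primrec.fst.comp Primrec.fst).pair Primrec.snd)
      (Primrec.snd.comp (Primrec.unpair.comp (Primrec.snd.comp Primrec.fst)))
  · constructor
    · rintro ⟨b, hb⟩
      obtain ⟨k, hk⟩ := (h (a, b)).1 hb
      exact ⟨Nat.pair (Encodable.encode b) k, by simpa using hk⟩
    · rintro ⟨k, hk⟩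
      cases hd : Encodable.decode (α := β) k.unpair.1 with
      | none => simp [hd] at hk
      | some b =>
        refine ⟨b, (h (a, b)).2 ⟨k.unpair.2, ?_⟩⟩
        simpa [hd] using hk

/-- The shape of most c.e. definitions below: some certificate passes a primitive recursive test
and names an element of a given c.e. set. -/
theorem rePred_exists_and {p : γ → Prop} (hp : REPred p) {f : α → β → γ} (hf : Primrec₂ f)
    {q : α → β → Prop} (hq : PrimrecRel q) : REPred fun a => ∃ b, p (f a b) ∧ q a b :=
  rePred_exists (rePred_and (rePred_comp hp hf) (rePred_of_primrecPred hq))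

end Computability

/-! ### Quantifier-free formulas on finite graphs -/

theorem getD_zero_lt {l : List ℕ} {N : ℕ} (hN : 0 < N) (h : ∀ x ∈ l, x < N) (i : ℕ) :
    l.getD i 0 < N := by
  by_cases hi : i < l.length
  · rw [List.getD_eq_getElem _ _ hi]
    exact h _ (List.getElem_mem hi)
  · rwa [List.getD_eq_default _ _ (not_lt.1 hi)]

theorem getD_map_range {α : Type*} (g : ℕ → α) {m i : ℕ} (x : α) (hi : i < m) :
    ((List.range m).map g).getD i x = g i := by
  simp [List.getD_eq_getElem?_getD, hi]

/-- Adjacency in the finite graph with the matrix `A`; there are no edges outside the matrix. -/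
def adj (A : List (List Bool)) (i j : ℕ) : Prop := (A.getD i []).getD j false = true

theorem primrec_adj {α : Type*} [Primcodable α] {A : α → List (List Bool)} {i j : α → ℕ}
    (hA : Primrec A) (hi : Primrec i) (hj : Primrec j) :
    PrimrecPred fun a => adj (A a) (i a) (j a) :=
  Primrec.eq.comp ((Primrec.list_getD false).comp ((Primrec.list_getD []).comp hA hi) hj)
    (Primrec.const true)

open Classical in
/-- The `N × N` matrix of the relation `r`. -/
noncomputable def matrixOf (N : ℕ) (r : ℕ → ℕ → Prop) : List (List Bool) :=
  (List.range N).map fun i => (List.range N).map fun j => decide (r i j)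

theorem adj_matrixOf {N : ℕ} {r : ℕ → ℕ → Prop} {i j : ℕ} (hi : i < N) (hj : j < N) :
    adj (matrixOf N r) i j ↔ r i j := by
  simp [adj, matrixOf, List.getD_eq_getElem?_getD, hi, hj]

theorem QF.code_surjective : Function.Surjective QF.code := by
  intro c
  induction c using Nat.strong_induction_on with
  | _ c ih =>
    have hc := Nat.div_add_mod c 5
    have h₅ : c % 5 < 5 := Nat.mod_lt _ (by norm_num)
    have hp : Nat.pair (c / 5).unpair.1 (c / 5).unpair.2 = c / 5 := Nat.pair_unpair _
    have hl := Nat.unpair_left_le (c / 5)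
    have hr := Nat.unpair_right_le (c / 5)
    generalize c % 5 = r at hc h₅
    interval_cases r
    · exact ⟨.eq (c / 5).unpair.1 (c / 5).unpair.2, by rw [QF.code, hp]; omega⟩
    · exact ⟨.mem (c / 5).unpair.1 (c / 5).unpair.2, by rw [QF.code, hp]; omega⟩
    · obtain ⟨φ, h⟩ := ih (c / 5) (by omega)
      exact ⟨.not φ, by rw [QF.code, h]; omega⟩
    · obtain ⟨φ, h⟩ := ih (c / 5).unpair.1 (by omega)
      obtain ⟨ψ, h'⟩ := ih (c / 5).unpair.2 (by omega)
      exact ⟨.and φ ψ, by rw [QF.code, h, h', hp]; omega⟩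
    · obtain ⟨φ, h⟩ := ih (c / 5).unpair.1 (by omega)
      obtain ⟨ψ, h'⟩ := ih (c / 5).unpair.2 (by omega)
      exact ⟨.or φ ψ, by rw [QF.code, h, h', hp]; omega⟩

/-- The formula with a given code; every natural number is the code of exactly one formula. -/
noncomputable def QF.ofCode : ℕ → QF := Function.surjInv QF.code_surjective

@[simp] theorem QF.code_ofCode (c : ℕ) : (QF.ofCode c).code = c :=
  Function.surjInv_eq QF.code_surjective c

@[simp] theorem QF.ofCode_code (γ : QF) : QF.ofCode γ.code = γ :=
  QF.code_injective (QF.code_ofCode _)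

theorem QF.ofCode_eq_iff {c : ℕ} {γ : QF} : QF.ofCode c = γ ↔ c = γ.code :=
  ⟨fun h => by rw [← h, QF.code_ofCode], fun h => by rw [h, QF.ofCode_code]⟩

theorem QF.mem_image_code {S : Set QF} {c : ℕ} : c ∈ QF.code '' S ↔ QF.ofCode c ∈ S :=
  ⟨by rintro ⟨γ, h, rfl⟩; simpa using h, fun h => ⟨_, h, by simp⟩⟩

/-- Only variables with index at most the code of a formula occur in it. -/
theorem QF.realize_congr {M : Type*} {E : M → M → Prop} {v w : ℕ → M} (γ : QF)
    (h : ∀ i ≤ γ.code, v i = w i) : γ.Realize E v ↔ γ.Realize E w := by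
  induction γ with
  | eq i j =>
    have hl := Nat.left_le_pair i j
    have hr := Nat.right_le_pair i j
    simp only [QF.code] at h
    simp only [QF.Realize]
    rw [h i (by omega), h j (by omega)]
  | mem i j =>
    have hl := Nat.left_le_pair i j
    have hr := Nat.right_le_pair i j
    simp only [QF.code] at h
    simp only [QF.Realize]
    rw [h i (by omega), h j (by omega)]
  | not φ ih =>
    simp only [QF.code] at h
    exact not_congr (ih fun i hi => h i (by omega))
  | and φ ψ ih₁ ih₂ =>
    have hl := Nat.left_le_pair φ.code ψ.code
    have hr := Nat.right_le_pair φ.code ψ.code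
    simp only [QF.code] at h
    exact and_congr (ih₁ fun i hi => h i (by omega)) (ih₂ fun i hi => h i (by omega))
  | or φ ψ ih₁ ih₂ =>
    have hl := Nat.left_le_pair φ.code ψ.code
    have hr := Nat.right_le_pair φ.code ψ.code
    simp only [QF.code] at h
    exact or_congr (ih₁ fun i hi => h i (by omega)) (ih₂ fun i hi => h i (by omega))

/-- Quantifier-free formulas are absolute between a structure and its induced substructures. -/
theorem QF.realize_comp {M N : Type*} {E : M → M → Prop} {R : N → N → Prop} {s : Set N}
    {f : N → M} (hf : Set.InjOn f s) (hE : ∀ i ∈ s, ∀ j ∈ s, R i j ↔ E (f i) (f j))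
    {v : ℕ → N} (hv : ∀ i, v i ∈ s) (γ : QF) :
    γ.Realize R v ↔ γ.Realize E fun i => f (v i) := by
  induction γ with
  | eq i j => exact (hf.eq_iff (hv i) (hv j)).symm
  | mem i j => exact hE _ (hv i) _ (hv j)
  | not φ ih => exact not_congr ih
  | and φ ψ ih₁ ih₂ => exact and_congr ih₁ ih₂
  | or φ ψ ih₁ ih₂ => exact or_congr ih₁ ih₂

/-- Truth in finite graphs is primitive recursive: a course-of-values recursion on the code. -/
theorem primrecPred_realize : PrimrecPred fun x : (List (List Bool) × List ℕ) × ℕ =>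
    (QF.ofCode x.2).Realize (adj x.1.1) fun i => x.1.2.getD i 0 := by
  classical
  let T : List (List Bool) × List ℕ → ℕ → Bool := fun x c =>
    decide ((QF.ofCode c).Realize (adj x.1) fun i => x.2.getD i 0)
  let g : List (List Bool) × List ℕ → List Bool → Bool := fun x l =>
    let q := l.length / 5
    let a := q.unpair.1
    let b := q.unpair.2
    if l.length % 5 = 0 then decide (x.2.getD a 0 = x.2.getD b 0)
    else if l.length % 5 = 1 then decide (adj x.1 (x.2.getD a 0) (x.2.getD b 0))
    else if l.length % 5 = 2 then !(l.getD q false)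
    else if l.length % 5 = 3 then l.getD a false && l.getD b false
    else l.getD a false || l.getD b false
  have hg : Primrec₂ g := by
    have hlen : Primrec fun z : (List (List Bool) × List ℕ) × List Bool => z.2.length :=
      Primrec.list_length.comp Primrec.snd
    have hq : Primrec fun z : (List (List Bool) × List ℕ) × List Bool => z.2.length / 5 :=
      Primrec.nat_div.comp hlen (Primrec.const 5)
    have hm : Primrec fun z : (List (List Bool) × List ℕ) × List Bool => z.2.length % 5 :=
      Primrec.nat_mod.comp hlen (Primrec.const 5)
    have ha := Primrec.fst.comp (Primrec.unpair.comp hq)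
    have hb := Primrec.snd.comp (Primrec.unpair.comp hq)
    have hw : Primrec fun z : (List (List Bool) × List ℕ) × List Bool => z.1.2 :=
      Primrec.snd.comp Primrec.fst
    have hA : Primrec fun z : (List (List Bool) × List ℕ) × List Bool => z.1.1 :=
      Primrec.fst.comp Primrec.fst
    have hwa := (Primrec.list_getD 0).comp hw ha
    have hwb := (Primrec.list_getD 0).comp hw hb
    have hl {i : (List (List Bool) × List ℕ) × List Bool → ℕ} (hi : Primrec i) :
        Primrec fun z : (List (List Bool) × List ℕ) × List Bool => z.2.getD (i z) false :=
      (Primrec.list_getD false).comp Primrec.snd hi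
    have he (r : ℕ) := Primrec.eq.comp hm (Primrec.const r)
    refine Primrec.ite (he 0) (Primrec.eq.comp hwa hwb).decide
      (Primrec.ite (he 1) (primrec_adj hA hwa hwb).decide
      (Primrec.ite (he 2) (Primrec.not.comp (hl hq))
      (Primrec.ite (he 3) (Primrec.and.comp (hl ha) (hl hb)) (Primrec.or.comp (hl ha) (hl hb)))))
  have hT : Primrec₂ T := by
    refine Primrec.nat_strong_rec T (Primrec.option_some.comp₂ hg) fun x c => ?_
    have hl : ∀ i < c, ((List.range c).map (T x)).getD i false = T x i := fun i hi => by
      simp [List.getD_eq_getElem?_getD, hi]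
    obtain ⟨γ, rfl⟩ := QF.code_surjective c
    have hpair (i j : ℕ) := And.intro (Nat.left_le_pair i j) (Nat.right_le_pair i j)
    congr 1
    simp only [g, List.length_map, List.length_range]
    cases γ with
    | eq i j =>
      have h₁ : (QF.eq i j).code % 5 = 0 := by simp only [QF.code]; omega
      have h₂ : (QF.eq i j).code / 5 = Nat.pair i j := by simp only [QF.code]; omega
      simp [h₁, h₂, T, QF.Realize]
    | mem i j =>
      have h₁ : (QF.mem i j).code % 5 = 1 := by simp only [QF.code]; omega
      have h₂ : (QF.mem i j).code / 5 = Nat.pair i j := by simp only [QF.code]; omega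
      simp [h₁, h₂, T, QF.Realize]
    | not φ =>
      have h₁ : (QF.not φ).code % 5 = 2 := by simp only [QF.code]; omega
      have h₂ : (QF.not φ).code / 5 = φ.code := by simp only [QF.code]; omega
      rw [h₁, h₂, hl _ (by simp only [QF.code]; omega)]
      simp [T, QF.Realize]
    | and φ ψ =>
      have h₁ : (QF.and φ ψ).code % 5 = 3 := by simp only [QF.code]; omega
      have h₂ : (QF.and φ ψ).code / 5 = Nat.pair φ.code ψ.code := by simp only [QF.code]; omega
      have := hpair φ.code ψ.code
      rw [h₁, h₂, Nat.unpair_pair, hl φ.code (by simp only [QF.code]; omega),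
        hl ψ.code (by simp only [QF.code]; omega)]
      simp [T, QF.Realize]
    | or φ ψ =>
      have h₁ : (QF.or φ ψ).code % 5 = 4 := by simp only [QF.code]; omega
      have h₂ : (QF.or φ ψ).code / 5 = Nat.pair φ.code ψ.code := by simp only [QF.code]; omega
      have := hpair φ.code ψ.code
      rw [h₁, h₂, Nat.unpair_pair, hl φ.code (by simp only [QF.code]; omega),
        hl ψ.code (by simp only [QF.code]; omega)]
      simp [T, QF.Realize]
  exact Primrec.primrecPred hT

/-! ### Finite graphs inside a model of `ZF` -/

section Models

universe u

variable {M : Type u} {E : M → M → Prop}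

theorem IsModelZF.exists_finset (hM : IsModelZF E) (S : Finset M) : ∃ c, ∀ x, E x c ↔ x ∈ S := by
  classical
  induction S using Finset.induction_on with
  | empty =>
    obtain ⟨w, ⟨z, -, hz⟩, -⟩ := hM.infinity
    exact ⟨z, fun x => by simpa using hz x⟩
  | insert a S _ ih =>
    obtain ⟨c, hc⟩ := ih
    obtain ⟨s, hs⟩ := hM.pairing a a
    obtain ⟨p, hp⟩ := hM.pairing s c
    obtain ⟨d, hd⟩ := hM.union p
    refine ⟨d, fun x => ?_⟩
    simp [hd, hp, hs, hc]

theorem IsModelZF.exists_minimal (hM : IsModelZF E) {S : Finset M} (hS : S.Nonempty) :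
    ∃ x ∈ S, ∀ y ∈ S, ¬ E y x := by
  obtain ⟨c, hc⟩ := hM.exists_finset S
  obtain ⟨a, ha⟩ := hS
  obtain ⟨x, hx, h⟩ := hM.foundation c ⟨a, (hc a).2 ha⟩
  exact ⟨x, (hc x).1 hx, fun y hy hyx => h y hyx ((hc y).2 hy)⟩

theorem IsModelZF.irrefl (hM : IsModelZF E) (a : M) : ¬ E a a := by
  obtain ⟨x, hx, h⟩ := hM.exists_minimal (Finset.singleton_nonempty a)
  obtain rfl := Finset.mem_singleton.1 hx
  exact h x hx

/-- A finite set `S` of vertices of `⟨M, E⟩` has a new vertex whose predecessors in `S` are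
prescribed, and which is itself a predecessor of no vertex in `S`. -/
theorem IsModelZF.exists_new_vertex (hM : IsModelZF E) (S : Finset M) (p : M → Prop) :
    ∃ y, y ∉ S ∧ (∀ s ∈ S, E s y ↔ p s) ∧ (∀ s ∈ S, ¬ E y s) := by
  classical
  obtain ⟨c, hc⟩ := hM.exists_finset S
  obtain ⟨c₁, hc₁⟩ := hM.union c
  obtain ⟨c₂, hc₂⟩ := hM.union c₁
  obtain ⟨d, hd⟩ := hM.exists_finset {c, c₁, c₂}
  -- `w = S ∪ ⋃ S ∪ ⋃ ⋃ S` is a member of no set in `S` or `⋃ S`, because `w ∉ w`.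
  obtain ⟨w, hw⟩ := hM.union d
  simp only [hd, Finset.mem_insert, Finset.mem_singleton, exists_eq_or_imp, exists_eq_left,
    hc₂, hc₁, hc] at hw
  have hww := hM.irrefl w
  obtain ⟨y, hy⟩ := hM.exists_finset (insert w (S.filter p))
  have hwy : E w y := (hy w).2 (Finset.mem_insert_self _ _)
  have hwS : w ∉ S := fun h => hww ((hw w).2 (by simp [h]))
  refine ⟨y, fun h => hww ((hw w).2 (Or.inr (Or.inl ⟨y, h, hwy⟩))), fun s hs => ?_, fun s hs h =>
    hww ((hw w).2 (Or.inr (Or.inr ⟨y, ⟨s, hs, h⟩, hwy⟩)))⟩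
  have : s ≠ w := fun h => hwS (h ▸ hs)
  simp [hy, this, hs]

theorem IsModelZF.infinite (hM : IsModelZF E) : Infinite M := by
  refine ⟨fun hfin => ?_⟩
  have := Fintype.ofFinite M
  obtain ⟨y, hy, -⟩ := hM.exists_new_vertex Finset.univ fun _ => True
  exact hy (Finset.mem_univ y)

/-- The graph `A` on the vertices `0, …, N - 1` is *layered* over its first `k` vertices: every
other vertex has edges only to later vertices. In particular those first `k` vertices are closed
under predecessors, and the vertices added to them span an acyclic graph. -/
def Layered (A : List (List Bool)) (k N : ℕ) : Prop :=
  ∀ i < N, ∀ j < N, adj A i j → (i < k ∧ j < k) ∨ i < j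

theorem primrec_layered {α : Type*} [Primcodable α] {A : α → List (List Bool)} {k N : α → ℕ}
    (hA : Primrec A) (hk : Primrec k) (hN : Primrec N) :
    PrimrecPred fun a => Layered (A a) (k a) (N a) := by
  refine primrecPred_forall_lt (primrecPred_forall_lt ?_ (hN.comp Primrec.fst)) hN
  have ha : Primrec fun z : (α × ℕ) × ℕ => z.1.1 := Primrec.fst.comp Primrec.fst
  have hi : Primrec fun z : (α × ℕ) × ℕ => z.1.2 := Primrec.snd.comp Primrec.fst
  exact primrecPred_imp (primrec_adj (hA.comp ha) hi Primrec.snd)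
    (((Primrec.nat_lt.comp hi (hk.comp ha)).and (Primrec.nat_lt.comp Primrec.snd (hk.comp ha))).or
      (Primrec.nat_lt.comp hi Primrec.snd))

/-- `f` embeds the graph `A` on the vertices `0, …, N - 1` into `⟨M, E⟩` as an induced subgraph. -/
def Embeds (E : M → M → Prop) (A : List (List Bool)) (N : ℕ) (f : ℕ → M) : Prop :=
  Set.InjOn f (Set.Iio N) ∧ ∀ i < N, ∀ j < N, adj A i j ↔ E (f i) (f j)

theorem Embeds.realize_iff {A : List (List Bool)} {N : ℕ} {f : ℕ → M} (hf : Embeds E A N f)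
    {v : ℕ → ℕ} (hv : ∀ i, v i < N) (γ : QF) :
    γ.Realize (adj A) v ↔ γ.Realize E fun i => f (v i) :=
  QF.realize_comp (s := Set.Iio N) hf.1 hf.2 hv γ

/-- An embedding of the first `k` vertices of a layered graph into a model of `ZF` extends to the
whole graph. -/
theorem IsModelZF.exists_embeds (hM : IsModelZF E) {A : List (List Bool)} {k N : ℕ} (hkN : k ≤ N)
    (hA : Layered A k N) {f₀ : ℕ → M} (hf₀ : Embeds E A k f₀) :
    ∃ f, (∀ i < k, f i = f₀ i) ∧ Embeds E A N f := by
  classical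
  induction N, hkN using Nat.le_induction with
  | base => exact ⟨f₀, fun _ _ => rfl, hf₀⟩
  | succ N hkN ih =>
    obtain ⟨f, hf, hinj, hE⟩ := ih fun i hi j hj => hA i (by omega) j (by omega)
    obtain ⟨y, hy, hp, hs⟩ := hM.exists_new_vertex ((Finset.range N).image f)
      fun x => ∃ i < N, f i = x ∧ adj A i N
    simp only [Finset.mem_image, Finset.mem_range, forall_exists_index, and_imp,
      forall_apply_eq_imp_iff₂] at hy hp hs
    have hne : ∀ i < N, Function.update f N y i = f i := fun i hi =>
      Function.update_of_ne hi.ne _ _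
    refine ⟨Function.update f N y, fun i hi => by rw [hne i (by omega), hf i hi], ?_, ?_⟩
    · intro i hi j hj hij
      have hi : i < N + 1 := hi
      have hj : j < N + 1 := hj
      rcases Nat.lt_succ_iff_lt_or_eq.1 hi with hi | rfl <;>
        rcases Nat.lt_succ_iff_lt_or_eq.1 hj with hj | rfl
      · rw [hne i hi, hne j hj] at hij
        exact hinj hi hj hij
      · rw [hne i hi, Function.update_self] at hij
        exact (hy ⟨i, hi, hij⟩).elim
      · rw [hne j hj, Function.update_self] at hij
        exact (hy ⟨j, hj, hij.symm⟩).elim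
      · rfl
    · intro i hi j hj
      rcases Nat.lt_succ_iff_lt_or_eq.1 hi with hi' | rfl <;>
        rcases Nat.lt_succ_iff_lt_or_eq.1 hj with hj' | rfl
      · rw [hne i hi', hne j hj']
        exact hE i hi' j hj'
      · rw [hne i hi', Function.update_self, hp i hi']
        exact ⟨fun h => ⟨i, hi', rfl, h⟩, fun ⟨i', h, he, ha⟩ => hinj h hi' he ▸ ha⟩
      · rw [hne j hj', Function.update_self]
        exact iff_of_false (fun h => by have := hA _ hi _ hj h; omega) (hs j hj')
      · rw [Function.update_self]
        exact iff_of_false (fun h => by have := hA _ hi _ hj h; omega) (hM.irrefl y)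

/-- A finite nonempty induced subgraph of a model of `ZF` can be enumerated as a layered graph over
its vertices in any set `Q` that is closed under predecessors; `ix` is the inverse enumeration. -/
theorem IsModelZF.exists_layered (hM : IsModelZF E) {S : Finset M} (hS : S.Nonempty) {Q : Set M}
    (hQ : ∀ s t, E s t → t ∈ Q → s ∈ Q) :
    ∃ (A : List (List Bool)) (k N : ℕ) (f : ℕ → M) (ix : M → ℕ), k ≤ N ∧ Layered A k N ∧
      Embeds E A N f ∧ (∀ i < N, f i ∈ S) ∧ (∀ i < N, i < k ↔ f i ∈ Q) ∧ (∀ x, ix x < N) ∧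
      ∀ x ∈ S, f (ix x) = x := by
  classical
  have sorted : ∀ (m : ℕ) (T : Finset M), T.card = m →
      ∃ l : List M, l.Nodup ∧ (∀ x, x ∈ l ↔ x ∈ T) ∧ l.Pairwise fun a b => ¬ E b a := by
    intro m
    induction m with
    | zero =>
      intro T hT
      obtain rfl := Finset.card_eq_zero.1 hT
      exact ⟨[], by simp⟩
    | succ m ih =>
      intro T hT
      obtain ⟨x, hx, hmin⟩ := hM.exists_minimal (Finset.card_pos.1 (by omega : 0 < T.card))
      obtain ⟨l, hl, hmem, hp⟩ := ih (T.erase x) (by rw [Finset.card_erase_of_mem hx]; omega)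
      refine ⟨x :: l, List.nodup_cons.2 ⟨by simp [hmem], hl⟩, fun y => ?_,
        List.pairwise_cons.2 ⟨fun b hb => hmin b (Finset.mem_of_mem_erase ((hmem b).1 hb)), hp⟩⟩
      by_cases hy : y = x <;> simp [hmem, hy, hx]
  obtain ⟨a₀, ha₀⟩ := hS
  obtain ⟨l, hl, hmem, hp⟩ := sorted _ (S.filter (· ∉ Q)) rfl
  set l₀ := (S.filter (· ∈ Q)).toList with hl₀
  have hmem₀ : ∀ x, x ∈ l₀ ↔ x ∈ S ∧ x ∈ Q := fun x => by simp [hl₀]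
  have hmem : ∀ x, x ∈ l ↔ x ∈ S ∧ x ∉ Q := fun x => by simp [hmem]
  set L := l₀ ++ l with hL
  have hmemL : ∀ x, x ∈ L ↔ x ∈ S := fun x => by
    rw [hL, List.mem_append, hmem₀, hmem]; tauto
  have hnodup : L.Nodup := List.nodup_append.2 ⟨Finset.nodup_toList _, hl, fun x hx y hy h =>
    ((hmem y).1 hy).2 (h ▸ ((hmem₀ x).1 hx).2)⟩
  set f : ℕ → M := fun i => L.getD i a₀ with hf
  have hfL : ∀ i (hi : i < L.length), f i = L[i] := fun i hi => by
    simp [hf, List.getD_eq_getElem?_getD, hi]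
  have hlen : L.length = l₀.length + l.length := List.length_append
  have hfQ : ∀ i < L.length, i < l₀.length ↔ f i ∈ Q := by
    intro i hi
    rw [hfL i hi]
    simp only [hL, List.getElem_append]
    split_ifs with h
    · exact iff_of_true h ((hmem₀ _).1 (List.getElem_mem h)).2
    · exact iff_of_false h ((hmem _).1 (List.getElem_mem _)).2
  have hinj : Set.InjOn f (Set.Iio L.length) := fun i hi j hj h => by
    rw [hfL i hi, hfL j hj] at h
    exact (hnodup.getElem_inj_iff).1 h
  have hix : ∀ x, L.idxOf x < L.length ∨ x ∉ S := fun x => by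
    rw [List.idxOf_lt_length_iff, hmemL]; tauto
  have hpos : 0 < L.length := List.length_pos_of_mem ((hmemL a₀).2 ha₀)
  refine ⟨matrixOf L.length fun i j => E (f i) (f j), l₀.length, L.length, f,
    fun x => if x ∈ S then L.idxOf x else 0, by omega, ?_, ⟨hinj, fun i hi j hj =>
      adj_matrixOf hi hj⟩, fun i hi => ?_, hfQ, fun x => ?_, fun x hx => ?_⟩
  · intro i hi j hj h
    rw [adj_matrixOf hi hj] at h
    by_contra! hc
    obtain ⟨h₁, h₂⟩ := hc
    have hj' : ¬ j < l₀.length := fun hj' => by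
      have := h₁ ((hfQ i hi).2 (hQ _ _ h ((hfQ j hj).1 hj')))
      omega
    rw [hfL i hi, hfL j hj] at h
    simp only [hL, List.getElem_append, dif_neg hj', dif_neg (by omega : ¬ i < l₀.length)] at h
    rcases eq_or_lt_of_le h₂ with rfl | h₂
    · exact hM.irrefl _ h
    · exact List.pairwise_iff_getElem.1 hp (j - l₀.length) (i - l₀.length) _ _ (by omega) h
  · rw [hfL i hi, ← hmemL]
    exact List.getElem_mem hi
  · dsimp only
    split_ifs with hx
    · exact (hix x).resolve_right (not_not.2 hx)
    · exact hpos
  · dsimp only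
    rw [if_pos hx, hfL _ ((hix x).resolve_right (not_not.2 hx))]
    exact List.getElem_idxOf _

end Models

/-! ### Presentations -/

/-- A finite partial injection from `ℕ` into a countably infinite set extends to a bijection. -/
theorem exists_equiv_extending {M : Type*} [Countable M] [Infinite M] {N : ℕ} {f : ℕ → M}
    (hf : Set.InjOn f (Set.Iio N)) : ∃ e : ℕ ≃ M, ∀ i < N, e i = f i := by
  classical
  let s : Set ℕ := Set.Iio N
  let t : Set M := f '' s
  have hs : s.Finite := Set.finite_Iio N
  have : Infinite ↑sᶜ := hs.infinite_compl.to_subtype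
  have : Infinite ↑tᶜ := (hs.image f).infinite_compl.to_subtype
  obtain ⟨h⟩ := nonempty_equiv_of_countable (α := ↑sᶜ) (β := ↑tᶜ)
  let g : s ≃ t := hf.bijOn_image.equiv f
  refine ⟨(Equiv.Set.sumCompl s).symm.trans ((Equiv.sumCongr g h).trans (Equiv.Set.sumCompl t)),
    fun i hi => ?_⟩
  have hi' : i ∈ s := hi
  simp only [Equiv.trans_apply, Equiv.Set.sumCompl_symm_apply_of_mem hi', Equiv.sumCongr_apply,
    Sum.map_inl, Equiv.Set.sumCompl_apply_inl]
  rfl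

theorem QF.realize_presentation {M : Type*} {E : M → M → Prop} (e : ℕ ≃ M) {v : ℕ → ℕ} (γ : QF) :
    γ.Realize (fun i j => E (e i) (e j)) v ↔ γ.Realize E fun i => e (v i) :=
  γ.realize_comp (s := Set.univ) e.injective.injOn (fun _ _ _ _ => Iff.rfl)
    fun _ => Set.mem_univ _

/-- The presentation of `⟨M, E⟩` on `ℕ` that a bijection with `M` induces. -/
def presentation {M : Type*} (E : M → M → Prop) (e : ℕ ≃ M) :
    (fun i j => E (e i) (e j)) ≃r E := ⟨e, Iff.rfl⟩

/-! ### Enumeration reducibility to the existential diagram is computable enumerability -/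

theorem EReducible.of_rePred {S : Set ℕ} (hS : REPred fun x => x ∈ S) (A : Set ℕ) :
    EReducible S A :=
  ⟨⟨{p | p.2 ∈ S}, rePred_comp hS Primrec.snd⟩, Set.ext fun _ =>
    ⟨fun ⟨_, h, _⟩ => h, fun h => ⟨[], h, by simp⟩⟩⟩

section Diagram

universe u

variable {M : Type u} {E : M → M → Prop}

theorem UniformlyEReducibleToDiagrams.of_rePred {S : Set ℕ} (hS : REPred fun x => x ∈ S) :
    UniformlyEReducibleToDiagrams E S :=
  ⟨⟨{p | p.2 ∈ S}, rePred_comp hS Primrec.snd⟩, fun _ _ => Set.ext fun _ =>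
    ⟨fun ⟨_, h, _⟩ => h, fun h => ⟨[], h, by simp⟩⟩⟩

/-- The list of parameters of the existential statement with code `d`. -/
def params (d : ℕ) : List ℕ := Denumerable.ofNat (List ℕ) d.unpair.2

theorem mem_sigmaOneDiagramWithParams {R : ℕ → ℕ → Prop} {d : ℕ} :
    d ∈ sigmaOneDiagramWithParams R ↔ (QF.ofCode d.unpair.1).ExRealize R (params d).get := by
  constructor
  · rintro ⟨γ, p, rfl, h⟩
    rw [params, Nat.unpair_pair, QF.ofCode_code, Denumerable.ofNat_encode]
    exact h
  · intro h
    exact ⟨_, _, by simp [params], h⟩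

/-- Some presentation of `⟨M, E⟩` has all statements from the list `D` in its existential diagram
with parameters. -/
def Satisfiable (E : M → M → Prop) (D : List ℕ) : Prop :=
  ∃ e : ℕ ≃ M, ∀ d ∈ D, d ∈ sigmaOneDiagramWithParams fun i j => E (e i) (e j)

/-- A finite certificate for `Satisfiable E D`: a layered graph `A` on the vertices `0, …, N - 1`,
the list `π` of the distinct vertices that interpret the parameters `0, 1, …`, and for each
statement in `D` a list `vs i` of vertices that witness its existential quantifiers. -/
def Certifies (D : List ℕ) (c : (List (List Bool) × ℕ) × List ℕ × List (List ℕ)) : Prop :=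
  0 < c.1.2 ∧ Layered c.1.1 0 c.1.2 ∧
  (∀ i < c.2.1.length, ∀ j < c.2.1.length, c.2.1.getD i 0 = c.2.1.getD j 0 → i = j) ∧
  (∀ x ∈ c.2.1, x < c.1.2) ∧
  ∀ i < D.length, (∀ x ∈ params (D.getD i 0), x < c.2.1.length) ∧
    (∀ x ∈ c.2.2.getD i [], x < c.1.2) ∧
    (QF.ofCode (D.getD i 0).unpair.1).Realize (adj c.1.1) fun j =>
      ((params (D.getD i 0)).map (fun x => c.2.1.getD x 0) ++ c.2.2.getD i []).getD j 0

theorem primrec_params : Primrec params :=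
  (Primrec.ofNat (List ℕ)).comp (Primrec.snd.comp Primrec.unpair)

theorem primrec_certifies : PrimrecRel Certifies := by
  have hD : Primrec fun z : List ℕ × ((List (List Bool) × ℕ) × List ℕ × List (List ℕ)) => z.1 :=
    Primrec.fst
  have hA : Primrec fun z : List ℕ × ((List (List Bool) × ℕ) × List ℕ × List (List ℕ)) =>
    z.2.1.1 := Primrec.fst.comp (Primrec.fst.comp Primrec.snd)
  have hN : Primrec fun z : List ℕ × ((List (List Bool) × ℕ) × List ℕ × List (List ℕ)) =>
    z.2.1.2 := Primrec.snd.comp (Primrec.fst.comp Primrec.snd)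
  have hπ : Primrec fun z : List ℕ × ((List (List Bool) × ℕ) × List ℕ × List (List ℕ)) =>
    z.2.2.1 := Primrec.fst.comp (Primrec.snd.comp Primrec.snd)
  have hv : Primrec fun z : List ℕ × ((List (List Bool) × ℕ) × List ℕ × List (List ℕ)) =>
    z.2.2.2 := Primrec.snd.comp (Primrec.snd.comp Primrec.snd)
  have hl := Primrec.list_length.comp hπ
  refine (Primrec.nat_lt.comp (Primrec.const 0) hN).and
    ((primrec_layered hA (Primrec.const 0) hN).and (PrimrecPred.and ?_ (PrimrecPred.and ?_ ?_)))
  · refine primrecPred_forall_lt (primrecPred_forall_lt (primrecPred_imp ?_ ?_)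
      (hl.comp Primrec.fst)) hl
    · exact Primrec.eq.comp
        ((Primrec.list_getD 0).comp (hπ.comp (Primrec.fst.comp Primrec.fst))
          (Primrec.snd.comp Primrec.fst))
        ((Primrec.list_getD 0).comp (hπ.comp (Primrec.fst.comp Primrec.fst)) Primrec.snd)
    · exact Primrec.eq.comp (Primrec.snd.comp Primrec.fst) Primrec.snd
  · exact primrecPred_forall_mem (Primrec.nat_lt.comp Primrec.snd (hN.comp Primrec.fst)) hπ
  · refine primrecPred_forall_lt ?_ (Primrec.list_length.comp hD)
    have hd := (Primrec.list_getD 0).comp (hD.comp Primrec.fst) (Primrec.snd (β := ℕ))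
    have hp := primrec_params.comp hd
    have hw := (Primrec.list_getD []).comp (hv.comp Primrec.fst) (Primrec.snd (β := ℕ))
    refine PrimrecPred.and ?_ (PrimrecPred.and ?_ ?_)
    · exact primrecPred_forall_mem
        (Primrec.nat_lt.comp Primrec.snd (hl.comp (Primrec.fst.comp Primrec.fst))) hp
    · exact primrecPred_forall_mem
        (Primrec.nat_lt.comp Primrec.snd (hN.comp (Primrec.fst.comp Primrec.fst))) hw
    · exact primrecPred_realize.comp (((hA.comp Primrec.fst).pair (Primrec.list_append.comp
        (Primrec.list_map hp ((Primrec.list_getD 0).comp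
          (hπ.comp (Primrec.fst.comp Primrec.fst)) Primrec.snd).to₂) hw)).pair
        (Primrec.fst.comp (Primrec.unpair.comp hd)))

theorem IsModelZF.satisfiable_of_certifies [Countable M] (hM : IsModelZF E) {D : List ℕ}
    {c : (List (List Bool) × ℕ) × List ℕ × List (List ℕ)} (h : Certifies D c) :
    Satisfiable E D := by
  obtain ⟨⟨A, N⟩, π, vs⟩ := c
  obtain ⟨hN, hA, hinj, hπ, hD⟩ := h
  dsimp only at hN hA hinj hπ hD
  have := hM.infinite
  obtain ⟨f, -, hf⟩ := hM.exists_embeds (Nat.zero_le N) hA (f₀ := fun _ => Classical.arbitrary M)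
    ⟨fun i hi => absurd hi (Nat.not_lt_zero i), fun i hi => absurd hi (Nat.not_lt_zero i)⟩
  have hπN := getD_zero_lt hN hπ
  obtain ⟨e, he⟩ := exists_equiv_extending (N := π.length) (f := fun i => f (π.getD i 0))
    fun i hi j hj h => hinj i hi j hj (hf.1 (hπN i) (hπN j) h)
  refine ⟨e, fun d hd => ?_⟩
  obtain ⟨i, hi, rfl⟩ := List.getElem_of_mem hd
  obtain ⟨hp, hw, hr⟩ := hD i hi
  rw [mem_sigmaOneDiagramWithParams]
  rw [List.getD_eq_getElem _ _ hi] at hp hr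
  set p := params D[i] with hpd
  set w := vs.getD i [] with hwd
  set v : ℕ → ℕ := fun j => (p.map (fun x => π.getD x 0) ++ w).getD j 0 with hv
  have hvN := getD_zero_lt (l := p.map (fun x => π.getD x 0) ++ w) hN fun y hy => by
    rcases List.mem_append.1 hy with h | h
    · obtain ⟨x, -, rfl⟩ := List.mem_map.1 h
      exact hπN x
    · exact hw y h
  refine ⟨fun j => e.symm (f (v j)), fun j => ?_, ?_⟩
  · have hvj : v j = π.getD (p.get j) 0 := by
      simp only [hv]
      rw [List.getD_append _ _ _ _ (by simp), List.getD_eq_getElem _ _ (by simp)]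
      simp
    dsimp only
    rw [hvj, ← he _ (hp _ (List.get_mem p j)), Equiv.symm_apply_apply]
  · rw [QF.realize_presentation]
    simp only [Equiv.apply_symm_apply]
    exact (hf.realize_iff hvN _).1 hr

theorem IsModelZF.exists_certifies (hM : IsModelZF E) {D : List ℕ} (h : Satisfiable E D) :
    ∃ c, Certifies D c := by
  classical
  obtain ⟨e, he⟩ := h
  have he : ∀ d, ∃ v : ℕ → ℕ, d ∈ D → (∀ i : Fin (params d).length, v i = (params d).get i) ∧
      (QF.ofCode d.unpair.1).Realize E fun i => e (v i) := by
    intro d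
    by_cases hd : d ∈ D
    · obtain ⟨v, hv, hr⟩ := mem_sigmaOneDiagramWithParams.1 (he d hd)
      refine ⟨v, fun _ => ⟨hv, ?_⟩⟩
      rwa [QF.realize_presentation] at hr
    · exact ⟨id, fun h => (hd h).elim⟩
  choose v hv using he
  -- `K` exceeds all parameters and all relevant values of the witnessing assignments.
  obtain ⟨K, hK⟩ : ∃ K : ℕ, 0 < K ∧ ∀ d ∈ D, (∀ x ∈ params d, x < K) ∧
      ∀ i ≤ d.unpair.1, v d i < K := by
    have : ∀ᶠ K : ℕ in Filter.atTop, 0 < K ∧ ∀ d ∈ D.toFinset,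
        (∀ x ∈ (params d).toFinset, x < K) ∧ ∀ i ∈ Finset.Iic d.unpair.1, v d i < K := by
      simp only [Filter.eventually_and, Filter.eventually_all_finset]
      exact ⟨Filter.eventually_gt_atTop _, fun d _ => ⟨fun x _ => Filter.eventually_gt_atTop _,
        fun i _ => Filter.eventually_gt_atTop _⟩⟩
    simpa using this.exists
  obtain ⟨hK₀, hK⟩ := hK
  obtain ⟨A, k, N, f, ix, hkN, hA, hf, hS, hQ, hix, hfix⟩ :=
    hM.exists_layered (S := (Finset.range K).image e) (by simpa using hK₀.ne') (Q := ∅)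
      (fun _ _ _ h => h)
  have hk : k = 0 := by
    by_contra h
    exact (hQ 0 (by omega)).1 (by omega)
  subst hk
  have hfe : ∀ i < K, f (ix (e i)) = e i := fun i hi => hfix _
    (Finset.mem_image_of_mem _ (Finset.mem_range.2 hi))
  have hN : 0 < N := (Nat.zero_le _).trans_lt (hix (e 0))
  let w : ℕ → List ℕ := fun d =>
    (List.range (d.unpair.1 + 1)).map fun i => ix (e (v d ((params d).length + i)))
  refine ⟨((A, N), (List.range K).map fun i => ix (e i), D.map w), hN, hA, ?_, ?_, ?_⟩
  · simp only [List.length_map, List.length_range]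
    intro i hi j hj h
    rw [getD_map_range _ _ hi, getD_map_range _ _ hj] at h
    have := congrArg f h
    rw [hfe i hi, hfe j hj] at this
    exact e.injective this
  · simp only [List.mem_map]
    rintro _ ⟨i, -, rfl⟩
    exact hix _
  · intro i hi
    have hd : D[i] ∈ D := List.getElem_mem hi
    rw [List.getD_eq_getElem _ _ hi, List.getD_eq_getElem _ _ (by simpa using hi),
      List.getElem_map]
    generalize D[i] = d at hd
    obtain ⟨hp, hvK⟩ := hK d hd
    obtain ⟨hvp, hr⟩ := hv d hd
    refine ⟨by simpa using hp, ?_, ?_⟩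
    · simp only [w, List.mem_map]
      rintro _ ⟨i, -, rfl⟩
      exact hix _
    have hmap : (params d).map (fun x => ((List.range K).map fun i => ix (e i)).getD x 0) =
        (params d).map fun x => ix (e x) :=
      List.map_congr_left fun x hx => getD_map_range _ _ (hp x hx)
    dsimp only
    rw [hmap]
    have key : ∀ j ≤ d.unpair.1,
        ((params d).map (fun x => ix (e x)) ++ w d).getD j 0 = ix (e (v d j)) := by
      intro j hj
      by_cases hjp : j < (params d).length
      · rw [List.getD_append _ _ _ _ (by simpa using hjp),
          List.getD_eq_getElem _ _ (by simpa using hjp), List.getElem_map]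
        have := hvp ⟨j, hjp⟩
        simp only [List.get_eq_getElem] at this
        rw [this]
      · rw [List.getD_append_right _ _ _ _ (by simpa using hjp), List.length_map]
        simp only [w]
        rw [getD_map_range _ _ (by omega), Nat.add_sub_cancel' (not_lt.1 hjp)]
    rw [QF.realize_congr _ (w := fun j => ix (e (v d j))) (by simpa using key),
      hf.realize_iff (fun j => hix _)]
    refine (QF.realize_congr _ fun j hj => ?_).1 hr
    rw [hfe _ (hvK j (by simpa using hj))]

theorem IsModelZF.rePred_satisfiable [Countable M] (hM : IsModelZF E) :
    REPred fun D => Satisfiable E D :=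
  (rePred_exists (rePred_of_primrecPred primrec_certifies)).of_eq fun _ =>
    ⟨fun ⟨_, h⟩ => hM.satisfiable_of_certifies h, hM.exists_certifies⟩

/-- If one enumeration operator produces `S` from every presentation, then a rule `(D, x)` shows
`x ∈ S` as soon as *some* presentation satisfies `D`. -/
theorem UniformlyEReducibleToDiagrams.rePred [Countable M] (hM : IsModelZF E) {S : Set ℕ}
    (h : UniformlyEReducibleToDiagrams E S) : REPred fun x => x ∈ S := by
  obtain ⟨Ψ, hΨ⟩ := h
  have := hM.infinite
  refine (rePred_exists (p := fun x D => (D, x) ∈ Ψ.rules ∧ Satisfiable E D)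
    (rePred_and (rePred_comp Ψ.ce (Primrec.snd.pair Primrec.fst))
      (rePred_comp hM.rePred_satisfiable Primrec.snd))).of_eq fun x => ⟨?_, fun hx => ?_⟩
  · rintro ⟨D, hD, e, he⟩
    rw [← hΨ _ ⟨presentation E e⟩]
    exact ⟨D, hD, he⟩
  · obtain ⟨e⟩ := nonempty_equiv_of_countable (α := ℕ) (β := M)
    rw [← hΨ _ ⟨presentation E e⟩] at hx
    obtain ⟨D, hD, hx⟩ := hx
    exact ⟨D, hD, e, hx⟩

theorem mem_sigmaOneDiagram_iff (e : ℕ ≃ M) {c : ℕ} : c ∈ sigmaOneDiagram E ↔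
    Nat.pair c 0 ∈ sigmaOneDiagramWithParams fun i j => E (e i) (e j) := by
  have h₀ : params (Nat.pair c 0) = [] := by simp [params]
  rw [mem_sigmaOneDiagramWithParams]
  simp only [Nat.unpair_pair]
  constructor
  · rintro ⟨γ, rfl, v, -, hv⟩
    refine ⟨fun i => e.symm (v i), fun i => ?_, ?_⟩
    · exact absurd i.2 (by simp [h₀])
    · rw [QF.ofCode_code, QF.realize_presentation]
      simpa using hv
  · rintro ⟨v, -, hv⟩
    refine ⟨_, (QF.code_ofCode c).symm, fun i => e (v i), fun i => i.elim0, ?_⟩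
    rwa [QF.realize_presentation] at hv

theorem EReducible.rePred [Countable M] (hM : IsModelZF E) {S : Set ℕ}
    (h : EReducible S (sigmaOneDiagram E)) : REPred fun x => x ∈ S := by
  obtain ⟨Ψ, rfl⟩ := h
  have := hM.infinite
  have hs : ∀ D : List ℕ, Satisfiable E (D.map fun c => Nat.pair c 0) ↔
      ∀ d ∈ D, d ∈ sigmaOneDiagram E := by
    intro D
    constructor
    · rintro ⟨e, he⟩ d hd
      exact (mem_sigmaOneDiagram_iff e).2 (he _ (List.mem_map_of_mem hd))
    · intro h
      obtain ⟨e⟩ := nonempty_equiv_of_countable (α := ℕ) (β := M)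
      refine ⟨e, fun d hd => ?_⟩
      obtain ⟨c, hc, rfl⟩ := List.mem_map.1 hd
      exact (mem_sigmaOneDiagram_iff e).1 (h c hc)
  refine (rePred_exists (p := fun x D => (D, x) ∈ Ψ.rules ∧
    Satisfiable E (D.map fun c => Nat.pair c 0))
    (rePred_and (rePred_comp Ψ.ce (Primrec.snd.pair Primrec.fst))
      (rePred_comp hM.rePred_satisfiable (Primrec.list_map Primrec.snd
        (Primrec₂.natPair.comp Primrec.snd (Primrec.const 0)))))).of_eq fun x => ?_
  simp only [hs]
  rfl

end Diagram

/-! ### Patterns and their codes -/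

/-- The raw data of a pattern: its size, the list of its distinguished vertices, its matrix. -/
def Pattern.data {n : ℕ} (p : Pattern n) : ℕ × List ℕ × List (List Bool) :=
  (p.size, List.ofFn fun i => (p.point i : ℕ), List.ofFn fun i => List.ofFn fun j => p.adj i j)

/-- The code of the pattern with data `d`. -/
def dataCode (d : ℕ × List ℕ × List (List Bool)) : ℕ :=
  Nat.pair d.1 (Nat.pair (Encodable.encode d.2.1) (Encodable.encode d.2.2))

theorem dataCode_injective : Function.Injective dataCode := by
  rintro ⟨k, l, A⟩ ⟨k', l', A'⟩ h
  simpa [dataCode, Nat.pair_eq_pair] using h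

theorem primrec_dataCode : Primrec dataCode :=
  Primrec₂.natPair.comp Primrec.fst (Primrec₂.natPair.comp
    (Primrec.encode.comp (Primrec.fst.comp Primrec.snd))
    (Primrec.encode.comp (Primrec.snd.comp Primrec.snd)))

/-- `d` is the data of a pattern with `n` distinguished vertices. -/
def IsPatternData (n : ℕ) (d : ℕ × List ℕ × List (List Bool)) : Prop :=
  d.2.1.length = n ∧ (∀ x ∈ d.2.1, x < d.1) ∧ d.2.2.length = d.1 ∧ ∀ r ∈ d.2.2, r.length = d.1

theorem primrec_isPatternData (n : ℕ) : PrimrecPred (IsPatternData n) := by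
  have hl : Primrec fun d : ℕ × List ℕ × List (List Bool) => d.2.1 := Primrec.fst.comp Primrec.snd
  have hA : Primrec fun d : ℕ × List ℕ × List (List Bool) => d.2.2 := Primrec.snd.comp Primrec.snd
  refine (Primrec.eq.comp (Primrec.list_length.comp hl) (Primrec.const n)).and
    (PrimrecPred.and ?_ ((Primrec.eq.comp (Primrec.list_length.comp hA) Primrec.fst).and ?_))
  · exact primrecPred_forall_mem (Primrec.nat_lt.comp Primrec.snd (Primrec.fst.comp Primrec.fst)) hl
  · exact primrecPred_forall_mem (Primrec.eq.comp (Primrec.list_length.comp Primrec.snd)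
      (Primrec.fst.comp Primrec.fst)) hA

theorem Pattern.isPatternData {n : ℕ} (p : Pattern n) : IsPatternData n p.data := by
  refine ⟨by simp [Pattern.data], ?_, by simp [Pattern.data], ?_⟩
  · simp only [Pattern.data, List.mem_ofFn]
    rintro _ ⟨i, rfl⟩
    exact (p.point i).2
  · simp only [Pattern.data, List.mem_ofFn]
    rintro _ ⟨i, rfl⟩
    simp

theorem IsPatternData.exists_data_eq {n : ℕ} {d : ℕ × List ℕ × List (List Bool)}
    (h : IsPatternData n d) : ∃ p : Pattern n, p.data = d := by
  obtain ⟨k, l, A⟩ := d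
  obtain ⟨rfl, hl, hA, hr⟩ := h
  dsimp only at hl hA hr
  refine ⟨⟨k, fun i => ⟨l[i], hl _ (List.getElem_mem _)⟩,
    fun i j => (A.getD i []).getD j false⟩, ?_⟩
  refine Prod.ext rfl (Prod.ext List.ofFn_getElem ?_)
  refine List.ext_getElem (by simp [Pattern.data, hA]) fun i hi _ => ?_
  have hi' : i < A.length := by simp_all
  refine List.ext_getElem (by simp [Pattern.data, hr _ (List.getElem_mem hi')]) fun j hj hj' => ?_
  simp [Pattern.data, hi', hj']

theorem Pattern.adj_data {n : ℕ} (p : Pattern n) (i j : Fin p.size) :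
    SetModel.adj p.data.2.2 i j ↔ p.adj i j = true := by
  simp [SetModel.adj, Pattern.data, List.getD_eq_getElem?_getD]

theorem Pattern.getD_data {n : ℕ} (p : Pattern n) (i : Fin n) :
    p.data.2.1.getD i 0 = p.point i := by
  simp [Pattern.data, List.getD_eq_getElem?_getD]

/-! ### From formulas to patterns -/

section FormulaToPattern

universe u

variable {M : Type u} {E : M → M → Prop}

/-- A certificate `((A, N), w)` that a quantifier-free formula (with code `c`) becomes true at every
tuple where the pattern with data `d` is found: a layered graph that extends the pattern, with an
assignment `w` of its vertices to the variables that makes the formula true. -/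
def Forces (n : ℕ) (d : ℕ × List ℕ × List (List Bool))
    (z : ((List (List Bool) × ℕ) × List ℕ) × ℕ) : Prop :=
  d.1 ≤ z.1.1.2 ∧ 0 < z.1.1.2 ∧ Layered z.1.1.1 d.1 z.1.1.2 ∧
  (∀ i < d.1, ∀ j < d.1, adj d.2.2 i j ↔ adj z.1.1.1 i j) ∧
  (∀ x ∈ z.1.2, x < z.1.1.2) ∧ (∀ i < n, z.1.2.getD i 0 = d.2.1.getD i 0) ∧
  (QF.ofCode z.2).Realize (adj z.1.1.1) fun i => z.1.2.getD i 0

theorem primrec_forces (n : ℕ) : PrimrecRel (Forces n) := by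
  have hk : Primrec fun y : (ℕ × List ℕ × List (List Bool)) ×
    (((List (List Bool) × ℕ) × List ℕ) × ℕ) => y.1.1 := Primrec.fst.comp Primrec.fst
  have hp : Primrec fun y : (ℕ × List ℕ × List (List Bool)) ×
    (((List (List Bool) × ℕ) × List ℕ) × ℕ) => y.1.2.1 :=
    Primrec.fst.comp (Primrec.snd.comp Primrec.fst)
  have hB : Primrec fun y : (ℕ × List ℕ × List (List Bool)) ×
    (((List (List Bool) × ℕ) × List ℕ) × ℕ) => y.1.2.2 :=
    Primrec.snd.comp (Primrec.snd.comp Primrec.fst)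
  have hA : Primrec fun y : (ℕ × List ℕ × List (List Bool)) ×
    (((List (List Bool) × ℕ) × List ℕ) × ℕ) => y.2.1.1.1 :=
    Primrec.fst.comp (Primrec.fst.comp (Primrec.fst.comp Primrec.snd))
  have hN : Primrec fun y : (ℕ × List ℕ × List (List Bool)) ×
    (((List (List Bool) × ℕ) × List ℕ) × ℕ) => y.2.1.1.2 :=
    Primrec.snd.comp (Primrec.fst.comp (Primrec.fst.comp Primrec.snd))
  have hw : Primrec fun y : (ℕ × List ℕ × List (List Bool)) ×
    (((List (List Bool) × ℕ) × List ℕ) × ℕ) => y.2.1.2 :=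
    Primrec.snd.comp (Primrec.fst.comp Primrec.snd)
  refine (Primrec.nat_le.comp hk hN).and ((Primrec.nat_lt.comp (Primrec.const 0) hN).and
    ((primrec_layered hA hk hN).and (PrimrecPred.and ?_ (PrimrecPred.and ?_
      (PrimrecPred.and ?_ ?_)))))
  · refine primrecPred_forall_lt (primrecPred_forall_lt ?_ (hk.comp Primrec.fst)) hk
    have h₁ := Primrec.snd.comp (Primrec.fst (α := ((ℕ × List ℕ × List (List Bool)) ×
      (((List (List Bool) × ℕ) × List ℕ) × ℕ)) × ℕ) (β := ℕ))
    exact primrecPred_iff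
      (primrec_adj (hB.comp (Primrec.fst.comp Primrec.fst)) h₁ Primrec.snd)
      (primrec_adj (hA.comp (Primrec.fst.comp Primrec.fst)) h₁ Primrec.snd)
  · exact primrecPred_forall_mem (Primrec.nat_lt.comp Primrec.snd (hN.comp Primrec.fst)) hw
  · exact primrecPred_forall_lt (Primrec.eq.comp
      ((Primrec.list_getD 0).comp (hw.comp Primrec.fst) Primrec.snd)
      ((Primrec.list_getD 0).comp (hp.comp Primrec.fst) Primrec.snd)) (Primrec.const n)
  · exact primrecPred_realize.comp ((hA.pair hw).pair (Primrec.snd.comp Primrec.snd))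

theorem IsModelZF.exRealize_of_forces (hM : IsModelZF E) {n : ℕ} {p : Pattern n} {γ : QF}
    {z : (List (List Bool) × ℕ) × List ℕ} (h : Forces n p.data (z, γ.code)) {a : Fin n → M}
    (hp : p.FoundAt E a) : γ.ExRealize E a := by
  classical
  obtain ⟨⟨A, N⟩, w⟩ := z
  obtain ⟨hkN, hN, hA, hadj, hw, hpt, hr⟩ := h
  dsimp only at hkN hN hA hadj hw hpt hr
  rw [QF.ofCode_code] at hr
  obtain ⟨f₀, hf₀, ha, -, hE⟩ := hp
  have := hM.infinite
  let g : ℕ → M := fun i => if h : i < p.size then f₀ ⟨i, h⟩ else Classical.arbitrary M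
  have hg : ∀ i (h : i < p.size), g i = f₀ ⟨i, h⟩ := fun i h => dif_pos h
  obtain ⟨f, hfg, hf⟩ := hM.exists_embeds (f₀ := g) hkN hA ⟨fun i hi j hj h => by
      rw [hg i hi, hg j hj] at h
      exact Fin.ext_iff.1 (hf₀ h),
    fun i hi j hj => by
      rw [hg i hi, hg j hj, ← hE, ← p.adj_data]
      exact (hadj i hi j hj).symm⟩
  refine ⟨fun i => f (w.getD i 0), fun i => ?_, (hf.realize_iff (getD_zero_lt hN hw) γ).1 hr⟩
  dsimp only
  rw [hpt i i.2, p.getD_data, hfg _ (p.point i).2, hg _ (p.point i).2, ha]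

/-- An existential formula that is true at `a` is forced by a pattern found at `a`: the part of its
witnesses that lies in the transitive closures of the `aᵢ`. -/
theorem IsModelZF.exists_forces (hM : IsModelZF E) {n : ℕ} {γ : QF} {a : Fin n → M}
    (h : γ.ExRealize E a) :
    ∃ (p : Pattern n) (z : (List (List Bool) × ℕ) × List ℕ),
      Forces n p.data (z, γ.code) ∧ p.FoundAt E a := by
  classical
  obtain ⟨v, hv, hr⟩ := h
  set K := γ.code + 1 + n with hK
  obtain ⟨A, k, N, f, ix, hkN, hA, hf, hS, hQ, hix, hfix⟩ :=
    hM.exists_layered (S := (Finset.range K).image v) (by simp [hK])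
      (Q := {s | ∃ i, s ∈ TC E (a i)})
      (fun s t hst ⟨i, hi⟩ => ⟨i, Relation.ReflTransGen.head hst hi⟩)
  have hfv : ∀ i < K, f (ix (v i)) = v i := fun i hi => hfix _
    (Finset.mem_image_of_mem _ (Finset.mem_range.2 hi))
  have hfa : ∀ i, f (ix (a i)) = a i := fun i => by rw [← hv i, hfv i (by omega)]
  have hak : ∀ i, ix (a i) < k := fun i => (hQ _ (hix _)).2 ⟨i, by
    rw [hfa]; exact Relation.ReflTransGen.refl⟩
  let p : Pattern n := ⟨k, fun i => ⟨ix (a i), hak i⟩, fun i j => decide (adj A i j)⟩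
  refine ⟨p, ((A, N), (List.range K).map fun i => ix (v i)),
    ⟨hkN, (Nat.zero_le _).trans_lt (hix (v 0)), hA, fun i hi j hj => ?_, ?_, fun i hi => ?_, ?_⟩,
    fun u => f u, fun u w h => ?_, hfa, fun u => (hQ u (u.2.trans_le hkN)).1 u.2, fun u w => ?_⟩
  · exact (p.adj_data ⟨i, hi⟩ ⟨j, hj⟩).trans (by simp [p])
  · simp only [List.mem_map]
    rintro _ ⟨i, -, rfl⟩
    exact hix _
  · rw [getD_map_range _ _ (by omega)]
    exact (congrArg ix (hv ⟨i, hi⟩)).trans (p.getD_data ⟨i, hi⟩).symm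
  · dsimp only
    rw [QF.ofCode_code, QF.realize_congr _ (w := fun j => ix (v j))
      (fun i hi => getD_map_range _ _ (by omega)), hf.realize_iff (fun j => hix _)]
    exact (QF.realize_congr _ fun j hj => (hfv j (by omega)).symm).1 hr
  · exact Fin.ext (hf.1 (u.2.trans_le hkN) (w.2.trans_le hkN) h)
  · rw [← hf.2 u (u.2.trans_le hkN) w (w.2.trans_le hkN)]
    simp [p]

theorem InfSigmaOne.Defines.exists_patterns (hM : IsModelZF E) {n : ℕ} {X : Set (Fin n → M)}
    {φ : InfSigmaOne n} (hφ : φ.Defines E X) (hce : REPred fun c => c ∈ QF.code '' φ.disjuncts) :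
    ∃ P : Set (Pattern n), WitnessesMembership E P X ∧ REPred fun c => c ∈ Pattern.code '' P := by
  refine ⟨{p | ∃ γ ∈ φ.disjuncts, ∃ z, Forces n p.data (z, γ.code)}, fun a => ?_, ?_⟩
  · rw [hφ a]
    constructor
    · rintro ⟨γ, hγ, h⟩
      obtain ⟨p, z, hz, hp⟩ := hM.exists_forces h
      exact ⟨p, ⟨γ, hγ, z, hz⟩, hp⟩
    · rintro ⟨p, ⟨γ, hγ, z, hz⟩, hp⟩
      exact ⟨γ, hγ, hM.exRealize_of_forces hz hp⟩
  · refine (rePred_exists_and hce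
      (β := (ℕ × List ℕ × List (List Bool)) × (((List (List Bool) × ℕ) × List ℕ) × ℕ))
      (f := fun _ y => y.2.2) (Primrec.snd.comp (Primrec.snd.comp Primrec.snd)).to₂
      (q := fun c y => (c = dataCode y.1 ∧ IsPatternData n y.1) ∧ Forces n y.1 y.2)
      (((Primrec.eq.comp Primrec.fst (primrec_dataCode.comp (Primrec.fst.comp Primrec.snd))).and
        ((primrec_isPatternData n).comp (Primrec.fst.comp Primrec.snd))).and
        ((primrec_forces n).comp (Primrec.fst.comp Primrec.snd)
          (Primrec.snd.comp Primrec.snd)))).of_eq fun c => ?_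
    constructor
    · rintro ⟨⟨d, z, _⟩, ⟨γ, hγ, rfl⟩, ⟨rfl, hd⟩, hf⟩
      obtain ⟨p, rfl⟩ := hd.exists_data_eq
      exact ⟨p, ⟨γ, hγ, z, hf⟩, rfl⟩
    · rintro ⟨p, ⟨γ, hγ, z, hf⟩, rfl⟩
      exact ⟨(p.data, z, γ.code), ⟨γ, hγ, rfl⟩, ⟨rfl, p.isPatternData⟩, hf⟩

end FormulaToPattern

/-! ### From patterns to a c.e. operator -/

theorem exists_path_of_reflTransGen {α : Type*} {r : α → α → Prop} {y z : α}
    (h : Relation.ReflTransGen r y z) :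
    ∃ (m : ℕ) (q : ℕ → α), q 0 = y ∧ q m = z ∧ ∀ i < m, r (q i) (q (i + 1)) := by
  induction h with
  | refl => exact ⟨0, fun _ => y, rfl, rfl, by simp⟩
  | @tail b c _ hbc ih =>
    obtain ⟨m, q, h₀, hm, hq⟩ := ih
    refine ⟨m + 1, fun i => if i ≤ m then q i else c, by simpa using h₀, by simp, fun i hi => ?_⟩
    rcases Nat.lt_succ_iff_lt_or_eq.1 hi with hi | rfl
    · simpa [hi.le, Nat.succ_le_iff.2 hi] using hq i hi
    · simpa [hm] using hbc

theorem reflTransGen_of_path {α : Type*} {r : α → α → Prop} {q : ℕ → α} {m : ℕ}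
    (h : ∀ i < m, r (q i) (q (i + 1))) : Relation.ReflTransGen r (q 0) (q m) := by
  induction m with
  | zero => exact .refl
  | succ m ih => exact (ih fun i hi => h i (by omega)).tail (h m (by omega))

/-- The binary relation that an initial segment of an atomic diagram describes. -/
def memBit (σ : List Bool) (i j : ℕ) : Prop := σ.getD (QF.mem i j).code false = true

theorem primrec_memBit {α : Type*} [Primcodable α] {σ : α → List Bool} {i j : α → ℕ}
    (hσ : Primrec σ) (hi : Primrec i) (hj : Primrec j) :
    PrimrecPred fun a => memBit (σ a) (i a) (j a) :=
  Primrec.eq.comp ((Primrec.list_getD false).comp hσ (Primrec.nat_add.comp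
    (Primrec.nat_mul.comp (Primrec.const 5) (Primrec₂.natPair.comp hi hj)) (Primrec.const 1)))
    (Primrec.const true)

theorem mem_code_mem_atomicDiagram {R : ℕ → ℕ → Prop} {i j : ℕ} :
    (QF.mem i j).code ∈ atomicDiagram R ↔ R i j := by
  constructor
  · rintro ⟨i', j', ⟨h, -⟩ | ⟨h, hR⟩⟩
    · exact QF.noConfusion (QF.code_injective h)
    · cases QF.code_injective h
      exact hR
  · exact fun h => ⟨i, j, Or.inr ⟨rfl, h⟩⟩

theorem eq_code_mem_atomicDiagram {R : ℕ → ℕ → Prop} {i j : ℕ} :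
    (QF.eq i j).code ∈ atomicDiagram R ↔ i = j := by
  constructor
  · rintro ⟨i', j', ⟨h, hR⟩ | ⟨h, -⟩⟩
    · cases QF.code_injective h
      exact hR
    · exact QF.noConfusion (QF.code_injective h)
  · exact fun h => ⟨i, j, Or.inl ⟨rfl, h⟩⟩

/-- `σ` is an initial segment of the characteristic function of `A`. -/
def IsInitialSegment (σ : List Bool) (A : Set ℕ) : Prop :=
  ∀ (i : ℕ) (h : i < σ.length), σ[i] = true ↔ i ∈ A

theorem exists_isInitialSegment (A : Set ℕ) (m : ℕ) :
    ∃ σ : List Bool, σ.length = m ∧ IsInitialSegment σ A := by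
  classical
  exact ⟨(List.range m).map fun i => decide (i ∈ A), by simp, fun i h => by simp⟩

theorem IsInitialSegment.memBit_iff {σ : List Bool} {R : ℕ → ℕ → Prop}
    (h : IsInitialSegment σ (atomicDiagram R)) {i j : ℕ} (hij : (QF.mem i j).code < σ.length) :
    memBit σ i j ↔ R i j := by
  rw [memBit, List.getD_eq_getElem _ _ hij, h, mem_code_mem_atomicDiagram]

/-- A certificate, to be checked against an initial segment `σ` of the atomic diagram of a
presentation, that the pattern with data `d` is found at the tuple listed in `x`: the list `l` of
images of the vertices of the pattern, and a list `q` of membership chains (each again a list) from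
these images to entries of `x`. All elements involved are less than `m`, and `σ` is long enough to
decide membership between such elements. -/
def FoundBelow (n : ℕ) (σ : List Bool) (d : ℕ × List ℕ × List (List Bool))
    (x l : List ℕ) (q : List (List ℕ)) (m : ℕ) : Prop :=
  (x.length = n ∧ ∀ i < n, x.getD i 0 = l.getD (d.2.1.getD i 0) 0) ∧
  (∀ u < d.1, l.getD u 0 < m ∧ (∀ y ∈ q.getD u [], y < m) ∧
    (q.getD u []).getD 0 0 = l.getD u 0 ∧
    (∃ i < n, (q.getD u []).getD ((q.getD u []).length - 1) 0 = x.getD i 0) ∧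
    ∀ i < (q.getD u []).length - 1,
      memBit σ ((q.getD u []).getD i 0) ((q.getD u []).getD (i + 1) 0)) ∧
  (∀ u < d.1, ∀ v < d.1, (l.getD u 0 = l.getD v 0 → u = v) ∧
    (adj d.2.2 u v ↔ memBit σ (l.getD u 0) (l.getD v 0))) ∧
  ∀ i < m, ∀ j < m, (QF.mem i j).code < σ.length

theorem primrec_foundBelow {α : Type*} [Primcodable α] (n : ℕ) {σ : α → List Bool}
    {d : α → ℕ × List ℕ × List (List Bool)} {x l : α → List ℕ} {q : α → List (List ℕ)}
    {m : α → ℕ} (hσ : Primrec σ) (hd : Primrec d) (hx : Primrec x) (hl : Primrec l)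
    (hq : Primrec q) (hm : Primrec m) :
    PrimrecPred fun a => FoundBelow n (σ a) (d a) (x a) (l a) (q a) (m a) := by
  have hk := Primrec.fst.comp hd
  have hp := Primrec.fst.comp (Primrec.snd.comp hd)
  have hA := Primrec.snd.comp (Primrec.snd.comp hd)
  have h₁ : Primrec fun y : (α × ℕ) × ℕ => y.1.1 := Primrec.fst.comp Primrec.fst
  have h₂ : Primrec fun y : (α × ℕ) × ℕ => y.1.2 := Primrec.snd.comp Primrec.fst
  have hqu := (Primrec.list_getD []).comp (hq.comp Primrec.fst) (Primrec.snd (α := α) (β := ℕ))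
  have hqu₂ := hqu.comp (Primrec.fst (α := α × ℕ) (β := ℕ))
  have hlast := Primrec.nat_sub.comp (Primrec.list_length.comp hqu) (Primrec.const 1)
  have hlu := (Primrec.list_getD 0).comp (hl.comp Primrec.fst) (Primrec.snd (α := α) (β := ℕ))
  have hlu₁ := (Primrec.list_getD 0).comp (hl.comp h₁) h₂
  have hlu₂ := (Primrec.list_getD 0).comp (hl.comp h₁) Primrec.snd
  have hxi := (Primrec.list_getD 0).comp (hx.comp Primrec.fst) (Primrec.snd (α := α) (β := ℕ))
  refine PrimrecPred.and (PrimrecPred.and ?_ ?_) (PrimrecPred.and ?_ (PrimrecPred.and ?_ ?_))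
  · exact Primrec.eq.comp (Primrec.list_length.comp hx) (Primrec.const n)
  · exact primrecPred_forall_lt (Primrec.eq.comp hxi ((Primrec.list_getD 0).comp
      (hl.comp Primrec.fst) ((Primrec.list_getD 0).comp (hp.comp Primrec.fst) Primrec.snd)))
      (Primrec.const n)
  · refine primrecPred_forall_lt (PrimrecPred.and ?_ (PrimrecPred.and ?_ (PrimrecPred.and ?_
      (PrimrecPred.and ?_ ?_)))) hk
    · exact Primrec.nat_lt.comp hlu (hm.comp Primrec.fst)
    · exact primrecPred_forall_mem (Primrec.nat_lt.comp Primrec.snd (hm.comp h₁)) hqu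
    · exact Primrec.eq.comp ((Primrec.list_getD 0).comp hqu (Primrec.const 0)) hlu
    · exact primrecPred_exists_lt (Primrec.eq.comp
        (((Primrec.list_getD 0).comp hqu hlast).comp Primrec.fst)
        ((Primrec.list_getD 0).comp (hx.comp h₁) Primrec.snd)) (Primrec.const n)
    · exact primrecPred_forall_lt (primrec_memBit (hσ.comp h₁)
        ((Primrec.list_getD 0).comp hqu₂ Primrec.snd)
        ((Primrec.list_getD 0).comp hqu₂ (Primrec.succ.comp Primrec.snd))) hlast
  · refine primrecPred_forall_lt (primrecPred_forall_lt (PrimrecPred.and ?_ ?_)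
      (hk.comp Primrec.fst)) hk
    · exact primrecPred_imp (Primrec.eq.comp hlu₁ hlu₂) (Primrec.eq.comp h₂ Primrec.snd)
    · exact primrecPred_iff (primrec_adj (hA.comp h₁) h₂ Primrec.snd)
        (primrec_memBit (hσ.comp h₁) hlu₁ hlu₂)
  · refine primrecPred_forall_lt (primrecPred_forall_lt (Primrec.nat_lt.comp ?_
      (Primrec.list_length.comp (hσ.comp h₁))) (hm.comp Primrec.fst)) hm
    exact Primrec.nat_add.comp (Primrec.nat_mul.comp (Primrec.const 5)
      (Primrec₂.natPair.comp h₂ Primrec.snd)) (Primrec.const 1)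

section PatternToOperator

universe u

variable {M : Type u} {E : M → M → Prop}

theorem FoundBelow.foundAt {n : ℕ} {R : ℕ → ℕ → Prop} (e : R ≃r E) {σ : List Bool}
    (hσ : IsInitialSegment σ (atomicDiagram R)) {p : Pattern n} {x l : List ℕ}
    {q : List (List ℕ)} {m : ℕ} (h : FoundBelow n σ p.data x l q m) :
    p.FoundAt E fun i => e (x.getD i 0) := by
  obtain ⟨⟨hx, hxl⟩, hq, hl, hm⟩ := h
  have hR : ∀ i < m, ∀ j < m, (memBit σ i j ↔ R i j) := fun i hi j hj =>
    hσ.memBit_iff (hm i hi j hj)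
  refine ⟨fun u => e (l.getD u 0), fun u v h => Fin.ext ((hl u u.2 v v.2).1 (e.injective h)),
    fun i => ?_, fun u => ?_, fun u v => ?_⟩
  · dsimp only
    rw [hxl i i.2, p.getD_data]
  · obtain ⟨-, hqm, h₀, ⟨i, hi, hlast⟩, hpath⟩ := hq u u.2
    refine ⟨⟨i, hi⟩, ?_⟩
    generalize q.getD u [] = c at hqm h₀ hlast hpath
    have hc : ∀ i < c.length, c.getD i 0 < m := fun i hi => by
      rw [List.getD_eq_getElem _ _ hi]
      exact hqm _ (List.getElem_mem hi)
    have := reflTransGen_of_path (r := R) (q := fun i => c.getD i 0) (m := c.length - 1)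
      fun i hi => (hR _ (hc _ (by omega)) _ (hc _ (by omega))).1 (hpath i hi)
    simp only [h₀, hlast] at this
    exact this.lift e fun _ _ h => e.map_rel_iff.2 h
  · rw [← p.adj_data, (hl u u.2 v v.2).2, hR _ (hq u u.2).1 _ (hq v v.2).1, e.map_rel_iff]

theorem Pattern.FoundAt.exists_foundBelow {n : ℕ} {R : ℕ → ℕ → Prop} (e : R ≃r E) {p : Pattern n}
    {x : Fin n → ℕ} (h : p.FoundAt E fun i => e (x i)) :
    ∃ σ l q m, IsInitialSegment σ (atomicDiagram R) ∧
      FoundBelow n σ p.data (List.ofFn x) l q m := by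
  classical
  obtain ⟨f, hf, hpt, htc, hE⟩ := h
  have hpath : ∀ u : Fin p.size, ∃ (i : Fin n) (m : ℕ) (q : ℕ → ℕ), q 0 = e.symm (f u) ∧
      q m = x i ∧ ∀ j < m, R (q j) (q (j + 1)) := by
    intro u
    obtain ⟨i, hi⟩ := htc u
    refine ⟨i, exists_path_of_reflTransGen ?_⟩
    have hi : Relation.ReflTransGen E (f u) (e (x i)) := hi
    have hR := hi.lift (p := R) e.symm fun _ _ h => e.symm.map_rel_iff.2 h
    rwa [Function.onFun, RelIso.symm_apply_apply] at hR
  choose ι len q h₀ hlast hq using hpath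
  -- Every chain `q u 0, …, q u (len u)` starts with the image of `u`, so `m` bounds the images too.
  obtain ⟨m, hm⟩ : ∃ m, ∀ u, ∀ i ≤ len u, q u i < m := by
    have : ∀ᶠ m : ℕ in Filter.atTop, ∀ u ∈ (Finset.univ : Finset (Fin p.size)),
        ∀ i ∈ Finset.Iic (len u), q u i < m := by
      simp only [Filter.eventually_all_finset]
      exact fun u _ i _ => Filter.eventually_gt_atTop _
    simpa using this.exists
  obtain ⟨σ, hlen, hσ⟩ := exists_isInitialSegment (atomicDiagram R) (5 * m ^ 2 + 2)
  have hcode : ∀ i < m, ∀ j < m, (QF.mem i j).code < σ.length := by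
    intro i hi j hj
    have h₁ := Nat.pair_lt_max_add_one_sq i j
    have h₂ : (max i j + 1) ^ 2 ≤ m ^ 2 := Nat.pow_le_pow_left (by omega) 2
    simp only [QF.code]
    omega
  have hR : ∀ i < m, ∀ j < m, (memBit σ i j ↔ R i j) := fun i hi j hj =>
    hσ.memBit_iff (hcode i hi j hj)
  set l := List.ofFn fun u => e.symm (f u) with hl
  set c := List.ofFn fun u => (List.range (len u + 1)).map (q u) with hc
  have hlu : ∀ u : Fin p.size, l.getD u 0 = e.symm (f u) := fun u => by
    simp [hl, List.getD_eq_getElem?_getD]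
  have hcu : ∀ u : Fin p.size, c.getD u [] = (List.range (len u + 1)).map (q u) := fun u => by
    simp [hc, List.getD_eq_getElem?_getD]
  have hxi : ∀ i : Fin n, (List.ofFn x).getD i 0 = x i := fun i => by
    simp [List.getD_eq_getElem?_getD]
  have hlm : ∀ u : Fin p.size, l.getD u 0 < m := fun u => by
    rw [hlu, ← h₀]
    exact hm u 0 (Nat.zero_le _)
  refine ⟨σ, l, c, m, hσ, ⟨by simp, fun i hi => ?_⟩, fun u hu => ?_, fun u hu v hv => ?_, hcode⟩
  · have h₁ := hxi ⟨i, hi⟩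
    have h₂ := p.getD_data ⟨i, hi⟩
    dsimp only at h₁ h₂
    rw [h₁, h₂, hlu, hpt]
    simp
  · lift u to Fin p.size using hu
    rw [hcu]
    refine ⟨hlm u, ?_, ?_, ⟨ι u, (ι u).2, ?_⟩, ?_⟩
    · simp only [List.mem_map, List.mem_range]
      rintro _ ⟨i, hi, rfl⟩
      exact hm u i (by omega)
    · rw [getD_map_range _ _ (by omega), h₀, hlu]
    · rw [List.length_map, List.length_range, getD_map_range _ _ (by omega), Nat.add_sub_cancel,
        hlast, hxi]
    · rw [List.length_map, List.length_range, Nat.add_sub_cancel]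
      intro i hi
      rw [getD_map_range _ _ (by omega), getD_map_range _ _ (by omega),
        hR _ (hm u i (by omega)) _ (hm u (i + 1) (by omega))]
      exact hq u i hi
  · lift u to Fin p.size using hu
    lift v to Fin p.size using hv
    rw [p.adj_data, hR _ (hlm u) _ (hlm v), hlu, hlu, hE]
    refine ⟨fun h => congrArg _ (hf (e.symm.injective h)), ?_⟩
    rw [e.symm.map_rel_iff]

theorem WitnessesMembership.uniformlyRICE {n : ℕ} {X : Set (Fin n → M)} {P : Set (Pattern n)}
    (hP : WitnessesMembership E P X) (hce : REPred fun c => c ∈ Pattern.code '' P) :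
    UniformlyRICE E X := by
  let rules : Set (List Bool × ℕ) := {r | ∃ y : (ℕ × List ℕ × List (List Bool)) ×
    (List ℕ × List ℕ × List (List ℕ) × ℕ), dataCode y.1 ∈ Pattern.code '' P ∧
      r.2 = Encodable.encode y.2.1 ∧ FoundBelow n r.1 y.1 y.2.1 y.2.2.1 y.2.2.2.1 y.2.2.2.2}
  have hrules : REPred fun r => r ∈ rules := by
    refine rePred_exists_and hce (α := List Bool × ℕ) (β := (ℕ × List ℕ × List (List Bool)) ×
      (List ℕ × List ℕ × List (List ℕ) × ℕ)) (f := fun _ y => dataCode y.1)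
      (primrec_dataCode.comp (Primrec.fst.comp Primrec.snd)).to₂
      (q := fun r y => r.2 = Encodable.encode y.2.1 ∧
        FoundBelow n r.1 y.1 y.2.1 y.2.2.1 y.2.2.2.1 y.2.2.2.2) ?_
    have hy := Primrec.snd.comp (Primrec.snd (α := List Bool × ℕ)
      (β := (ℕ × List ℕ × List (List Bool)) × (List ℕ × List ℕ × List (List ℕ) × ℕ)))
    have hx := Primrec.fst.comp hy
    have hl := Primrec.fst.comp (Primrec.snd.comp hy)
    have hq := Primrec.fst.comp (Primrec.snd.comp (Primrec.snd.comp hy))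
    have hm := Primrec.snd.comp (Primrec.snd.comp (Primrec.snd.comp hy))
    exact (Primrec.eq.comp (Primrec.snd.comp Primrec.fst) (Primrec.encode.comp hx)).and
      (primrec_foundBelow n (Primrec.fst.comp Primrec.fst) (Primrec.fst.comp Primrec.snd) hx hl hq
        hm)
  refine ⟨⟨rules, hrules⟩, fun R e => Set.ext fun t => ?_⟩
  constructor
  · rintro ⟨σ, ⟨⟨d, x, l, q, m⟩, ⟨p, hp, hpd⟩, rfl, hfound⟩, hσ⟩
    obtain rfl : p.data = d := dataCode_injective hpd
    have hlen := hfound.1.1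
    refine ⟨fun i => x.getD i 0, (hP _).2 ⟨p, hp, hfound.foundAt e hσ⟩, ?_⟩
    dsimp only [tupleCode] at hlen ⊢
    congr 1
    refine List.ext_getElem (by simp [hlen]) fun i hi hi' => ?_
    simp [hi']
  · rintro ⟨x, hx, rfl⟩
    obtain ⟨p, hp, hfound⟩ := (hP _).1 hx
    obtain ⟨σ, l, q, m, hσ, h⟩ := hfound.exists_foundBelow e
    exact ⟨σ, ⟨(p.data, List.ofFn x, l, q, m), ⟨p, hp, rfl⟩, rfl, h⟩, hσ⟩

end PatternToOperator

/-! ### From a c.e. operator to a formula -/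

/-- The code of the conjunction of the formulas with codes in `L` (and of `v₀ = v₀`). -/
def conjCode (L : List ℕ) : ℕ := L.foldr (fun c d => 5 * Nat.pair c d + 3) 0

theorem ofCode_conjCode_cons (c : ℕ) (L : List ℕ) :
    QF.ofCode (conjCode (c :: L)) = (QF.ofCode c).and (QF.ofCode (conjCode L)) :=
  QF.ofCode_eq_iff.2 (by simp [QF.code, conjCode])

theorem ofCode_zero : QF.ofCode 0 = QF.eq 0 0 := QF.ofCode_eq_iff.2 (by simp [QF.code, Nat.pair])

theorem realize_conjCode {M : Type*} {E : M → M → Prop} {v : ℕ → M} {L : List ℕ} :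
    (QF.ofCode (conjCode L)).Realize E v ↔ ∀ c ∈ L, (QF.ofCode c).Realize E v := by
  induction L with
  | nil =>
    have : conjCode [] = 0 := rfl
    simp [this, ofCode_zero, QF.Realize]
  | cons c L ih =>
    rw [ofCode_conjCode_cons, List.forall_mem_cons, ← ih]
    rfl

/-- The atomic formula with code `c`, with all variables shifted by `n`. If `c` is not the code of
an atomic formula, and thus in no atomic diagram, this is the false formula `¬ v₀ = v₀`. -/
def shiftAtom (n c : ℕ) : ℕ :=
  if c % 5 = 0 then (QF.eq (n + (c / 5).unpair.1) (n + (c / 5).unpair.2)).code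
  else if c % 5 = 1 then (QF.mem (n + (c / 5).unpair.1) (n + (c / 5).unpair.2)).code
  else (QF.not (.eq 0 0)).code

/-- The shifted atomic formula with code `c`, or its negation, as the string `σ` says. -/
def literal (n : ℕ) (σ : List Bool) (c : ℕ) : ℕ :=
  if σ.getD c false = true then shiftAtom n c else 5 * shiftAtom n c + 2

/-- The formula `v_{n+i} ≠ v_{n+j}`, where `i ≠ j` are the two components of `c`. -/
def distinct (n c : ℕ) : ℕ :=
  if c.unpair.1 = c.unpair.2 then (QF.eq 0 0).code
  else (QF.not (.eq (n + c.unpair.1) (n + c.unpair.2))).code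

/-- The formula that describes the use of an oracle computation. The variable `v_{n+i}` stands for
the element `i` of a presentation: the elements below `m` are distinct and satisfy the part of the
atomic diagram given by `σ`, and those listed in `x` are `v₀, …, v_{n-1}`. -/
def useFormula (n : ℕ) (σ : List Bool) (x : List ℕ) (m : ℕ) : ℕ :=
  conjCode ((List.range σ.length).map (literal n σ) ++
    ((List.range n).map (fun i => (QF.eq i (n + x.getD i 0)).code) ++
      (List.range (m * m)).map (distinct n)))

section Primrec

variable {α : Type*} [Primcodable α]

theorem primrec_eq_code {i j : α → ℕ} (hi : Primrec i) (hj : Primrec j) :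
    Primrec fun a => (QF.eq (i a) (j a)).code :=
  Primrec.nat_mul.comp (Primrec.const 5) (Primrec₂.natPair.comp hi hj)

theorem primrec_shiftAtom (n : ℕ) : Primrec (shiftAtom n) := by
  have hm : Primrec fun c => c % 5 := Primrec.nat_mod.comp Primrec.id (Primrec.const 5)
  have hq := Primrec.unpair.comp (Primrec.nat_div.comp Primrec.id (Primrec.const 5))
  have h := primrec_eq_code (Primrec.nat_add.comp (Primrec.const n) (Primrec.fst.comp hq))
    (Primrec.nat_add.comp (Primrec.const n) (Primrec.snd.comp hq))
  exact Primrec.ite (Primrec.eq.comp hm (Primrec.const 0)) h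
    (Primrec.ite (Primrec.eq.comp hm (Primrec.const 1)) (Primrec.succ.comp h) (Primrec.const _))

theorem primrec_literal (n : ℕ) : Primrec₂ (literal n) := by
  have h := (primrec_shiftAtom n).comp (Primrec.snd (α := List Bool) (β := ℕ))
  exact Primrec.ite (Primrec.eq.comp ((Primrec.list_getD false).comp Primrec.fst Primrec.snd)
    (Primrec.const true)) h
    (Primrec.nat_add.comp (Primrec.nat_mul.comp (Primrec.const 5) h) (Primrec.const 2))

theorem primrec_distinct (n : ℕ) : Primrec (distinct n) := by
  have hl := Primrec.fst.comp Primrec.unpair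
  have hr := Primrec.snd.comp Primrec.unpair
  exact Primrec.ite (Primrec.eq.comp hl hr) (Primrec.const _)
    (Primrec.nat_add.comp (Primrec.nat_mul.comp (Primrec.const 5)
      (primrec_eq_code (Primrec.nat_add.comp (Primrec.const n) hl)
        (Primrec.nat_add.comp (Primrec.const n) hr))) (Primrec.const 2))

theorem primrec_conjCode : Primrec conjCode :=
  Primrec.list_foldr Primrec.id (Primrec.const 0) (Primrec.nat_add.comp
    (Primrec.nat_mul.comp (Primrec.const 5) (Primrec₂.natPair.comp
      (Primrec.fst.comp Primrec.snd) (Primrec.snd.comp Primrec.snd))) (Primrec.const 3)).to₂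

theorem primrec_useFormula (n : ℕ) {σ : α → List Bool} {x : α → List ℕ} {m : α → ℕ}
    (hσ : Primrec σ) (hx : Primrec x) (hm : Primrec m) :
    Primrec fun a => useFormula n (σ a) (x a) (m a) := by
  refine primrec_conjCode.comp (Primrec.list_append.comp
    (Primrec.list_map (Primrec.list_range.comp (Primrec.list_length.comp hσ)) ?_)
    (Primrec.list_append.comp (Primrec.list_map (Primrec.const _) ?_)
      (Primrec.list_map (Primrec.list_range.comp (Primrec.nat_mul.comp hm hm)) ?_)))
  · exact (primrec_literal n).comp (hσ.comp Primrec.fst) Primrec.snd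
  · exact primrec_eq_code Primrec.snd (Primrec.nat_add.comp (Primrec.const n)
      ((Primrec.list_getD 0).comp (hx.comp Primrec.fst) Primrec.snd))
  · exact (primrec_distinct n).comp Primrec.snd

end Primrec

section OperatorToFormula

universe u

variable {M : Type u} {E : M → M → Prop}

theorem realize_shiftAtom {n c : ℕ} {v : ℕ → M} (e : ℕ ≃ M) (he : ∀ i ≤ c, e i = v (n + i)) :
    (QF.ofCode (shiftAtom n c)).Realize E v ↔ c ∈ atomicDiagram fun i j => E (e i) (e j) := by
  obtain ⟨γ, rfl⟩ := QF.code_surjective c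
  have hfalse : (h₀ : γ.code % 5 ≠ 0) → (h₁ : γ.code % 5 ≠ 1) →
      ((QF.ofCode (shiftAtom n γ.code)).Realize E v ↔
        γ.code ∈ atomicDiagram fun i j => E (e i) (e j)) := by
    intro h₀ h₁
    rw [shiftAtom, if_neg h₀, if_neg h₁, QF.ofCode_code]
    refine iff_of_false (fun h => h rfl) ?_
    rintro ⟨i, j, ⟨h, -⟩ | ⟨h, -⟩⟩ <;> simp only [h, QF.code] at h₀ h₁ <;> omega
  cases γ with
  | eq i j =>
    have h₁ : (QF.eq i j).code % 5 = 0 := by simp only [QF.code]; omega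
    have h₂ : (QF.eq i j).code / 5 = Nat.pair i j := by simp only [QF.code]; omega
    have hl := Nat.left_le_pair i j
    have hr := Nat.right_le_pair i j
    rw [eq_code_mem_atomicDiagram, shiftAtom, if_pos h₁, h₂, Nat.unpair_pair, QF.ofCode_code,
      ← e.injective.eq_iff, he i (by omega), he j (by omega)]
    rfl
  | mem i j =>
    have h₁ : (QF.mem i j).code % 5 = 1 := by simp only [QF.code]; omega
    have h₂ : (QF.mem i j).code / 5 = Nat.pair i j := by simp only [QF.code]; omega
    have hl := Nat.left_le_pair i j
    have hr := Nat.right_le_pair i j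
    rw [mem_code_mem_atomicDiagram, shiftAtom, if_neg (by omega), if_pos h₁, h₂, Nat.unpair_pair,
      QF.ofCode_code, he i (by omega), he j (by omega)]
    rfl
  | not φ => exact hfalse (by simp only [QF.code]; omega) (by simp only [QF.code]; omega)
  | and φ ψ => exact hfalse (by simp only [QF.code]; omega) (by simp only [QF.code]; omega)
  | or φ ψ => exact hfalse (by simp only [QF.code]; omega) (by simp only [QF.code]; omega)

theorem realize_literal {n : ℕ} {σ : List Bool} {c : ℕ} {v : ℕ → M} :
    (QF.ofCode (literal n σ c)).Realize E v ↔
      (σ.getD c false = true ↔ (QF.ofCode (shiftAtom n c)).Realize E v) := by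
  have hnot : QF.ofCode (5 * shiftAtom n c + 2) = (QF.ofCode (shiftAtom n c)).not :=
    QF.ofCode_eq_iff.2 (by simp [QF.code])
  rw [literal]
  split_ifs with h
  · simp only [h, true_iff]
  · rw [hnot, QF.Realize]
    simp only [h, Bool.false_eq_true, false_iff]

theorem realize_distinct {n c : ℕ} {v : ℕ → M} : (QF.ofCode (distinct n c)).Realize E v ↔
    (v (n + c.unpair.1) = v (n + c.unpair.2) → c.unpair.1 = c.unpair.2) := by
  rw [distinct]
  split_ifs with h <;> simp [QF.Realize, h]

theorem realize_useFormula {n : ℕ} {σ : List Bool} {x : List ℕ} {m : ℕ} {v : ℕ → M} :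
    (QF.ofCode (useFormula n σ x m)).Realize E v ↔
      (∀ c < σ.length, (QF.ofCode (literal n σ c)).Realize E v) ∧
      (∀ i < n, v i = v (n + x.getD i 0)) ∧
      ∀ c < m * m, (QF.ofCode (distinct n c)).Realize E v := by
  simp [useFormula, realize_conjCode, or_imp, forall_and, QF.Realize]

/-- The disjuncts describe the uses of all computations of the operator. A tuple that satisfies one
of them can be read off a presentation in which that computation takes place. -/
theorem UniformlyRICE.exists_formula [Countable M] [Infinite M] {n : ℕ} {X : Set (Fin n → M)}
    (hX : UniformlyRICE E X) :
    ∃ φ : InfSigmaOne n, φ.Defines E X ∧ REPred fun c => c ∈ QF.code '' φ.disjuncts := by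
  obtain ⟨W, hW⟩ := hX
  refine ⟨⟨{γ | ∃ y : List Bool × List ℕ × ℕ, (y.1, Encodable.encode y.2.1) ∈ W.rules ∧
    γ.code = useFormula n y.1 y.2.1 y.2.2 ∧ y.2.1.length = n ∧ (∀ i ∈ y.2.1, i < y.2.2) ∧
    y.1.length ≤ y.2.2}⟩, fun a => ?_, ?_⟩
  · constructor
    · intro ha
      obtain ⟨e⟩ := nonempty_equiv_of_countable (α := ℕ) (β := M)
      have hmem : tupleCode (fun i => e.symm (a i)) ∈
          W.apply (atomicDiagram fun i j => E (e i) (e j)) := by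
        rw [hW _ (presentation E e)]
        refine ⟨_, ?_, rfl⟩
        simpa [presentation] using ha
      obtain ⟨σ, hσW, hσ⟩ := hmem
      have hσ : IsInitialSegment σ (atomicDiagram fun i j => E (e i) (e j)) := hσ
      set x := List.ofFn fun i => e.symm (a i) with hx
      obtain ⟨m, hm⟩ : ∃ m, (∀ i ∈ x, i < m) ∧ σ.length ≤ m := by
        have : ∀ᶠ m : ℕ in Filter.atTop, (∀ i ∈ x.toFinset, i < m) ∧ σ.length ≤ m := by
          simp only [Filter.eventually_and, Filter.eventually_all_finset]
          exact ⟨fun i _ => Filter.eventually_gt_atTop _, Filter.eventually_ge_atTop _⟩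
        simpa using this.exists
      refine ⟨QF.ofCode (useFormula n σ x m), ⟨(σ, x, m), hσW, by simp, by simp [hx], hm⟩,
        fun i => if h : i < n then a ⟨i, h⟩ else e (i - n), fun i => by simp, ?_⟩
      rw [realize_useFormula]
      refine ⟨fun c hc => ?_, fun i hi => ?_, fun c _ => ?_⟩
      · rw [realize_literal, realize_shiftAtom e (fun i _ => by simp),
          List.getD_eq_getElem _ _ hc, hσ]
      · simp [hi, hx, List.getD_eq_getElem?_getD]
      · rw [realize_distinct]
        simp
    · rintro ⟨γ, ⟨⟨σ, x, m⟩, hσW, hγ, hlen, hxm, hσm⟩, v, hv, hr⟩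
      dsimp only at hσW hγ hlen hxm hσm
      obtain rfl := QF.ofCode_eq_iff.2 hγ.symm
      obtain ⟨hlit, heq, hdist⟩ := realize_useFormula.1 hr
      have hinj : Set.InjOn (fun i => v (n + i)) (Set.Iio m) := by
        intro i hi j hj hij
        have hi : i < m := hi
        have hj : j < m := hj
        have h₁ := Nat.pair_lt_max_add_one_sq i j
        have h₂ : (max i j + 1) ^ 2 ≤ m ^ 2 := Nat.pow_le_pow_left (by omega) 2
        have := realize_distinct.1 (hdist (Nat.pair i j) (by rw [← pow_two]; omega))
        rw [Nat.unpair_pair] at this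
        exact this hij
      obtain ⟨e, he⟩ := exists_equiv_extending hinj
      have hσ : IsInitialSegment σ (atomicDiagram fun i j => E (e i) (e j)) := by
        intro c hc
        have := realize_literal.1 (hlit c hc)
        rwa [List.getD_eq_getElem _ _ hc, realize_shiftAtom e fun i hi => he i (by omega)] at this
      have hmem : Encodable.encode x ∈ W.apply (atomicDiagram fun i j => E (e i) (e j)) :=
        ⟨σ, hσW, hσ⟩
      rw [hW _ (presentation E e)] at hmem
      obtain ⟨x', hx', hxx⟩ := hmem
      obtain rfl : List.ofFn x' = x := Encodable.encode_injective hxx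
      suffices h : a = fun i => e (x' i) by
        rw [h]
        exact hx'
      funext i
      have hi := heq i i.2
      rw [hv, List.getD_eq_getElem _ _ (by simp)] at hi
      simp only [List.getElem_ofFn] at hi
      rw [hi]
      exact (he _ (hxm _ (List.mem_ofFn.2 ⟨i, rfl⟩))).symm
  · refine (rePred_exists_and W.ce (α := ℕ) (β := List Bool × List ℕ × ℕ)
      (f := fun _ y => (y.1, Encodable.encode y.2.1)) ?_
      (q := fun c y => c = useFormula n y.1 y.2.1 y.2.2 ∧ y.2.1.length = n ∧
        (∀ i ∈ y.2.1, i < y.2.2) ∧ y.1.length ≤ y.2.2) ?_).of_eq fun c => ?_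
    · exact ((Primrec.fst.comp Primrec.snd).pair
        (Primrec.encode.comp (Primrec.fst.comp (Primrec.snd.comp Primrec.snd)))).to₂
    · have hσ := Primrec.fst.comp (Primrec.snd (α := ℕ) (β := List Bool × List ℕ × ℕ))
      have hx := Primrec.fst.comp (Primrec.snd.comp
        (Primrec.snd (α := ℕ) (β := List Bool × List ℕ × ℕ)))
      have hm := Primrec.snd.comp (Primrec.snd.comp
        (Primrec.snd (α := ℕ) (β := List Bool × List ℕ × ℕ)))
      have h₁ := primrecPred_forall_mem (p := fun (z : ℕ × List Bool × List ℕ × ℕ) i => i < z.2.2.2)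
        (Primrec.nat_lt.comp Primrec.snd (hm.comp Primrec.fst)) hx
      have h₂ := Primrec.nat_le.comp (Primrec.list_length.comp hσ) hm
      exact (Primrec.eq.comp Primrec.fst (primrec_useFormula n hσ hx hm)).and
        ((Primrec.eq.comp (Primrec.list_length.comp hx) (Primrec.const n)).and (h₁.and h₂))
    · simp only [QF.mem_image_code, Set.mem_ofPred_eq, QF.code_ofCode]

end OperatorToFormula

end SetModel

theorem mainTheorem6 {M : Type*} [Countable M] (E : M → M → Prop) (hM : SetModel.IsModelZF E)
    (n : ℕ) (hn : 1 ≤ n) (X : Set (Fin n → M)) :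
    List.TFAE [
      SetModel.UniformlyRICE E X,
      ∃ P : Set (SetModel.Pattern n), SetModel.WitnessesMembership E P X ∧
        SetModel.EReducible (SetModel.Pattern.code '' P) (SetModel.sigmaOneDiagram E),
      ∃ φ : SetModel.InfSigmaOne n, φ.Defines E X ∧
        SetModel.EReducible (SetModel.QF.code '' φ.disjuncts) (SetModel.sigmaOneDiagram E),
      ∃ P : Set (SetModel.Pattern n), SetModel.WitnessesMembership E P X ∧
        SetModel.UniformlyEReducibleToDiagrams E (SetModel.Pattern.code '' P),
      ∃ φ : SetModel.InfSigmaOne n, φ.Defines E X ∧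
        SetModel.UniformlyEReducibleToDiagrams E (SetModel.QF.code '' φ.disjuncts)] := by
  have := hM.infinite
  tfae_have 1 → 3 := by
    intro h
    obtain ⟨φ, hφ, hce⟩ := h.exists_formula
    exact ⟨φ, hφ, .of_rePred hce _⟩
  tfae_have 3 → 2 := by
    rintro ⟨φ, hφ, h⟩
    obtain ⟨P, hP, hce⟩ := hφ.exists_patterns hM (h.rePred hM)
    exact ⟨P, hP, .of_rePred hce _⟩
  tfae_have 2 → 1 := by
    rintro ⟨P, hP, h⟩
    exact hP.uniformlyRICE (h.rePred hM)
  tfae_have 3 → 5 := by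
    rintro ⟨φ, hφ, h⟩
    exact ⟨φ, hφ, .of_rePred (h.rePred hM)⟩
  tfae_have 5 → 3 := by
    rintro ⟨φ, hφ, h⟩
    exact ⟨φ, hφ, .of_rePred (h.rePred hM) _⟩
  tfae_have 2 → 4 := by
    rintro ⟨P, hP, h⟩
    exact ⟨P, hP, .of_rePred (h.rePred hM)⟩
  tfae_have 4 → 2 := by
    rintro ⟨P, hP, h⟩
    exact ⟨P, hP, .of_rePred (h.rePred hM) _⟩
  tfae_finish
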